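/- Consider the linear system $x_{t+1}=Ax_t+Bu_t+w_t$, $y_t=Cx_t+z_t$ with $x_t\in\mathbb R^n$ ($n\ge 1$), $u_t\in\mathbb R^p$, $y_t\in\mathbb R^m$ and noise covariances $\sigma_w^2 I$, $\sigma_z^2 I$ ($\sigma_w,\sigma_z>0$). Let $\Sigma\succeq 0$ solve the Riccati equation $$\Sigma=A\Sigma A^\top-A\Sigma C^\top(C\Sigma C^\top+\sigma_z^2I)^{-1}C\Sigma A^\top+\sigma_w^2I ,$$ and put $F=A\Sigma C^\top(C\Sigma C^\top+\sigma_z^2 I)^{-1}$ and $A_F=A-FC$. Assume $\rho(A)<1$, $(A,B)$ and $(A,F)$ controllable, and $(A,C)$ observable. For $H_e\ge1$ let $$\mathcal G_y=[CF,\ CA_FF,\ \dots,\ CA_F^{H_e-1}F,\ CB,\ CA_FB,\ \dots,\ CA_F^{H_e-1}B]\in\mathbb R^{m\times (m+p)H_e}.$$ *The procedure SysId.* The input is $\mathcal G=[F_1,\dots,F_{H_e},G_1,\dots,G_{H_e}]$ (with $F_j\in\mathbb R^{m\times m}$, $G_j\in\mathbb R^{m\times p}$), the order $n$, and integers $d_1,d_2\ge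 n$ with $d_1+d_2+1=H_e$. Form $\mathcal H=[\mathcal H_F,\mathcal H_G]$, where $\mathcal H_F,\mathcal H_G$ are the $d_1\times(d_2+1)$ block Hankel matrices with $(j,k)$ blocks $F_{j+k-1}$ and $G_{j+k-1}$. Let $\mathcal H^-$ (resp. $\mathcal H^+$) be $\mathcal H$ with the last (resp. first) block column of each of $\mathcal H_F$, $\mathcal H_G$ removed. Let $\mathcal N$ be obtained from a singular value decomposition of $\mathcal H^-$ by setting all but the top $n$ singular values to zero, let $\mathcal N=USV^\top$ be a singular value decomposition with $n$ terms, and put $O=US^{1/2}$, $R=S^{1/2}V^\top$. The output is $(A',B',C',F')$, where $C'$ is the first $m$ rows of $O$; $F'$ and $B'$ are the first $m$ columns of the $\mathcal H_F$-part and the first $p$ columns of the $\mathcal H_G$-part of $R$; and $A'=O^\dagger\mathcal H^+R^\dagger+F'C'$, with $\dagger$ the Moore–Penrose inverse. (Singular value decompositions are not unique; the result holds for every choice.) **Theorem (model parameters estimation error).** There is a constant $c_1>0$ depending only on the system such that for every regularization parameter $\lambda>0$ and every rate $\upsilon\in(0,1)$ there is a constant $c_H>0$ depending only on the system, $\lambda$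 and $\upsilon$ with the following property. Let $T\ge1$ be an integer (the horizon), let $$H_e\ \ge\ \max\Big\{2n+1,\ \frac{\log (c_HT^2\sqrt m/\sqrt\lambda)}{\log(1/\upsilon)}\Big\},$$ and let $d_1,d_2\ge n$ be any integers with $d_1+d_2+1=H_e$. Let $\mathcal H$ be the concatenation of the two Hankel matrices formed from the true $\mathcal G_y$. Then $\mathcal H$ has rank $n$; let $\sigma_n(\mathcal H)>0$ be its $n$-th largest singular value. Let $(\bar A,\bar B,\bar C,\bar F)$ be the parameters that SysId returns for the true $\mathcal G_y$. Let $(\widehat{\mathcal G}_t)_{t\ge0}$ be any sequence of estimates of $\mathcal G_y$ (for instance regularized least squares estimates), and let $T_{\mathcal G_y}\ge0$ be such that, in spectral norm, $\|\widehat{\mathcal G}_s-\mathcal G_y\|\le\sqrt{T_{\mathcal G_y}/s}$ for all $s\ge T_{\mathcal G_y}$ (so the error is at most $1$ from time $T_{\mathcal G_y}$ on). Put $$T_N=T_{\mathcal G_y}\frac{8H_e}{\sigma_n^2(\mathcal H)},\qquad T_B=T_{\mathcal G_y}\frac{20nH_e}{\sigma_n(\mathcal H)} .$$ Then for every $t\ge\max\{T_{\mathcal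 G_y},T_N,T_B\}$, if $(\hat A_t,\hat B_t,\hat C_t,\hat F_t)$ are the parameters that SysId returns for $\widehat{\mathcal G}_t$, there is an orthogonal matrix $\mathbf T\in\mathbb R^{n\times n}$ such that simultaneously, in spectral norm, $$\|\hat A_t-\mathbf T^\top\bar A\mathbf T\|\le c_1\,\frac{\sqrt{nH_e}\,(\|\mathcal H\|+\sigma_n(\mathcal H))}{\sigma_n^2(\mathcal H)}\,\|\widehat{\mathcal G}_t-\mathcal G_y\|,$$ $$\|\hat B_t-\mathbf T^\top\bar B\|,\ \ \|\hat C_t-\bar C\mathbf T\|,\ \ \|\hat F_t-\mathbf T^\top\bar F\|\ \le\ \sqrt{\frac{20nH_e}{\sigma_n(\mathcal H)}}\ \|\widehat{\mathcal G}_t-\mathcal G_y\| .$$ -/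

import Mathlib

open scoped Matrix Matrix.Norms.L2Operator

noncomputable section

namespace SysId

variable {n m p q d₁ d₂ He : ℕ}

/-- Extended controllability matrix `[B, AB, …, A^(k-1) B]`. -/
def ctrbMatrix (A : Matrix (Fin n) (Fin n) ℝ) (B : Matrix (Fin n) (Fin q) ℝ) (k : ℕ) :
    Matrix (Fin n) (Fin k × Fin q) ℝ :=
  Matrix.of fun i c => (A ^ (c.1 : ℕ) * B) i c.2

/-- Extended observability matrix, with block rows `C, CA, …, CA^(k-1)`. -/
def obsvMatrix (A : Matrix (Fin n) (Fin n) ℝ) (C : Matrix (Fin q) (Fin n) ℝ) (k : ℕ) :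
    Matrix (Fin k × Fin q) (Fin n) ℝ :=
  Matrix.of fun r j => (C * A ^ (r.1 : ℕ)) r.2 j

/-- The controllability matrix of length `n` has full row rank. -/
def IsControllable (A : Matrix (Fin n) (Fin n) ℝ) (B : Matrix (Fin n) (Fin q) ℝ) : Prop :=
  (ctrbMatrix A B n).rank = n

/-- The observability matrix of length `n` has full column rank. -/
def IsObservable (A : Matrix (Fin n) (Fin n) ℝ) (C : Matrix (Fin q) (Fin n) ℝ) : Prop :=
  (obsvMatrix A C n).rank = n

/-- Steady state Kalman gain in observer form, `F = A Σ Cᵀ (C Σ Cᵀ + σ_z² I)⁻¹`. -/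
def kalmanGain (A : Matrix (Fin n) (Fin n) ℝ) (C : Matrix (Fin m) (Fin n) ℝ)
    (S : Matrix (Fin n) (Fin n) ℝ) (σz : ℝ) : Matrix (Fin n) (Fin m) ℝ :=
  A * S * Cᵀ * (C * S * Cᵀ + σz ^ 2 • (1 : Matrix (Fin m) (Fin m) ℝ))⁻¹

/-- The system `x⁺ = A x + B u + w`, `y = C x + z`, with noise covariances `σ_w² I` and `σ_z² I`,
is stable, controllable, observable and controllable through its Kalman gain, and `S` is the
positive semidefinite solution of its discrete algebraic Riccati equation. -/
structure IsAdmissible (A : Matrix (Fin n) (Fin n) ℝ) (B : Matrix (Fin n) (Fin p) ℝ)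
    (C : Matrix (Fin m) (Fin n) ℝ) (σw σz : ℝ) (S : Matrix (Fin n) (Fin n) ℝ) : Prop where
  σw_pos : 0 < σw
  σz_pos : 0 < σz
  stable : spectralRadius ℂ (A.map (algebraMap ℝ ℂ)) < 1
  posSemidef : S.PosSemidef
  dare : S = A * S * Aᵀ
      - A * S * Cᵀ * (C * S * Cᵀ + σz ^ 2 • (1 : Matrix (Fin m) (Fin m) ℝ))⁻¹ * C * S * Aᵀ
      + σw ^ 2 • (1 : Matrix (Fin n) (Fin n) ℝ)
  controllable_B : IsControllable A B
  observable : IsObservable A C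
  controllable_F : IsControllable A (kalmanGain A C S σz)

/-- Column index of `k` blocks of width `m` followed by `k` blocks of width `p`. -/
abbrev Cols (k m p : ℕ) : Type := (Fin k × Fin m) ⊕ (Fin k × Fin p)

/-- `[CF, CĀF, …, CĀ^(He-1)F, CB, CĀB, …, CĀ^(He-1)B]` with `Ā = A - F C`. -/
def arxMatrix (A : Matrix (Fin n) (Fin n) ℝ) (B : Matrix (Fin n) (Fin p) ℝ)
    (C : Matrix (Fin m) (Fin n) ℝ) (F : Matrix (Fin n) (Fin m) ℝ) (He : ℕ) :
    Matrix (Fin m) (Cols He m p) ℝ :=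
  Matrix.of fun i c => match c with
    | Sum.inl (k, j) => (C * (A - F * C) ^ (k : ℕ) * F) i j
    | Sum.inr (k, j) => (C * (A - F * C) ^ (k : ℕ) * B) i j

/-- The two `d₁ × (d₂ + 1)` block Hankel matrices of `G = [F₁, …, F_He, G₁, …, G_He]`, side by
side. In one-based numbering the blocks at `(j, k)` are `F_(j+k-1)` and `G_(j+k-1)`. -/
def hankel (h : d₁ + d₂ + 1 = He) (G : Matrix (Fin m) (Cols He m p) ℝ) :
    Matrix (Fin d₁ × Fin m) (Cols (d₂ + 1) m p) ℝ :=
  Matrix.of fun r c => match c with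
    | Sum.inl (k, b) => G r.2 (Sum.inl (⟨(r.1 : ℕ) + (k : ℕ), by omega⟩, b))
    | Sum.inr (k, b) => G r.2 (Sum.inr (⟨(r.1 : ℕ) + (k : ℕ), by omega⟩, b))

/-- Discard the last block column of each of the two Hankel matrices. -/
def hankelMinus (H : Matrix (Fin d₁ × Fin m) (Cols (d₂ + 1) m p) ℝ) :
    Matrix (Fin d₁ × Fin m) (Cols d₂ m p) ℝ :=
  H.submatrix id (Sum.map (Prod.map Fin.castSucc id) (Prod.map Fin.castSucc id))

/-- Discard the first block column of each of the two Hankel matrices. -/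
def hankelPlus (H : Matrix (Fin d₁ × Fin m) (Cols (d₂ + 1) m p) ℝ) :
    Matrix (Fin d₁ × Fin m) (Cols d₂ m p) ℝ :=
  H.submatrix id (Sum.map (Prod.map Fin.succ id) (Prod.map Fin.succ id))

section LinearAlgebra

variable {ι κ : Type*} [Fintype ι] [Fintype κ] [DecidableEq ι] [DecidableEq κ]

/-- The `k`-th largest singular value, `k = 1, 2, …` (Mathlib counts from zero). -/
def sigma (k : ℕ) (M : Matrix ι κ ℝ) : ℝ :=
  (Matrix.toEuclideanLin M).singularValues (k - 1)

/-- `M = U diag(s) Vᵀ` is a (thin) singular value decomposition with `r` terms: orthonormal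
columns, nonnegative singular values in nonincreasing order. -/
structure IsSVD {r : ℕ} (M : Matrix ι κ ℝ) (U : Matrix ι (Fin r) ℝ) (s : Fin r → ℝ)
    (V : Matrix κ (Fin r) ℝ) : Prop where
  orthU : Uᵀ * U = 1
  orthV : Vᵀ * V = 1
  anti : Antitone s
  nonneg : ∀ i, 0 ≤ s i
  eq : M = U * Matrix.diagonal s * Vᵀ

/-- `N` arises from a singular value decomposition of `M` by setting all but the top `k` singular
values to zero. -/
def IsTruncation (k : ℕ) (M N : Matrix ι κ ℝ) : Prop :=
  ∃ (r : ℕ) (U : Matrix ι (Fin r) ℝ) (s : Fin r → ℝ) (V : Matrix κ (Fin r) ℝ),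
    IsSVD M U s V ∧
    N = U * Matrix.diagonal (fun i : Fin r => if (i : ℕ) < k then s i else 0) * Vᵀ

/-- `P` is the Moore-Penrose inverse of `M` (the four Penrose equations determine it). -/
structure IsMoorePenrose (M : Matrix ι κ ℝ) (P : Matrix κ ι ℝ) : Prop where
  mul_mul : M * P * M = M
  mul_mul' : P * M * P = P
  symm_left : (M * P)ᵀ = M * P
  symm_right : (P * M)ᵀ = P * M

end LinearAlgebra

/-- `(A, B, C, F)` is an output of the procedure SysId on the input `G` with order `n`; the
singular value decompositions that the procedure computes are not unique, and any choice counts.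
`N` is the rank-`n` truncation of `H⁻`, `O = U Σ^(1/2)` and `R = Σ^(1/2) Vᵀ` estimate the extended
observability and controllability matrices, and `Abar = O† H⁺ R†`. -/
def IsOutput (h : d₁ + d₂ + 1 = He) (hd₁ : 0 < d₁) (hd₂ : 0 < d₂)
    (G : Matrix (Fin m) (Cols He m p) ℝ)
    (A : Matrix (Fin n) (Fin n) ℝ) (B : Matrix (Fin n) (Fin p) ℝ)
    (C : Matrix (Fin m) (Fin n) ℝ) (F : Matrix (Fin n) (Fin m) ℝ) : Prop :=
  ∃ (N : Matrix (Fin d₁ × Fin m) (Cols d₂ m p) ℝ)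
    (U : Matrix (Fin d₁ × Fin m) (Fin n) ℝ) (s : Fin n → ℝ) (V : Matrix (Cols d₂ m p) (Fin n) ℝ)
    (O : Matrix (Fin d₁ × Fin m) (Fin n) ℝ) (R : Matrix (Fin n) (Cols d₂ m p) ℝ)
    (Odag : Matrix (Fin n) (Fin d₁ × Fin m) ℝ) (Rdag : Matrix (Cols d₂ m p) (Fin n) ℝ)
    (Abar : Matrix (Fin n) (Fin n) ℝ),
    IsTruncation n (hankelMinus (hankel h G)) N ∧
    IsSVD N U s V ∧
    O = U * Matrix.diagonal (fun i => √(s i)) ∧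
    R = Matrix.diagonal (fun i => √(s i)) * Vᵀ ∧
    C = Matrix.of (fun a i => O (⟨0, hd₁⟩, a) i) ∧
    B = Matrix.of (fun i b => R i (Sum.inr (⟨0, hd₂⟩, b))) ∧
    F = Matrix.of (fun i b => R i (Sum.inl (⟨0, hd₂⟩, b))) ∧
    IsMoorePenrose O Odag ∧
    IsMoorePenrose R Rdag ∧
    Abar = Odag * hankelPlus (hankel h G) * Rdag ∧
    A = Abar + F * C

end SysId

end

/-! The true Hankel matrix factors as observability times reachability matrix of `A - F * C`. Output
injection preserves observability and, dually, reachability from `F`, so both factors have rank `n`,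
and so has `H⁻`. Truncating the estimated `H⁻` to rank `n` moves it by at most twice the estimation
error, and two factorizations `O * R` with equal diagonal Gram matrices can be aligned by a single
rotation `Q` (`exists_orthogonal_trace_le`): the squared Frobenius error of both factors together is
at most `3 / τ` times that of the product, `τ` being a lower bound for the singular values of the
true `H⁻`. This controls `B`, `C`, `F`; for `A` one adds a perturbation bound for Moore-Penrose
inverses (`IsMoorePenrose.norm_sub_le`).

The delicate point is that waiting times and bounds are stated with `σ_n(H)`, while the perturbation
argument sees `σ_n(H⁻)`, which may be smaller. The Riccati equation, written as a Lyapunov equation,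
makes the powers of `A - F * C` square summable. Hence the last block column adds only a relative
amount `η d₂` to the reachability Gram matrix, with `η d → 0`, and `σ_n(H)² ≤ (1 + η d₂) σ_n(H⁻)²`
(`IsSVD.sigma_sq_le`, `exists_reachMatrix_succ_le`). For large `d₂` this loss is absorbed by the
slack in the constants 8 and 20. For small `d₂` the perturbation of `H⁻` is bounded through its few
block columns, by `m * d₂` instead of `He`, and `cH` is chosen so that `He` dominates the loss. The
same summability bounds `‖H‖` uniformly in the numbers of blocks, so that `c₁` depends on the system
only. -/

noncomputable section

namespace SysId

set_option linter.unusedSectionVars false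

/-! ### Spectral and Frobenius norms, polar decomposition, smallest nonzero singular value. -/

section Norms

variable {ι κ μ : Type*} [Fintype ι] [Fintype κ] [Fintype μ]
  [DecidableEq ι] [DecidableEq κ] [DecidableEq μ]

lemma norm_toLp_sq (x : ι → ℝ) : ‖(WithLp.toLp 2 x : EuclideanSpace ℝ ι)‖ ^ 2 = x ⬝ᵥ x := by
  rw [EuclideanSpace.norm_sq_eq]
  simp [dotProduct, sq]

lemma dotProduct_self_nonneg (x : ι → ℝ) : 0 ≤ x ⬝ᵥ x :=
  Finset.sum_nonneg fun i _ => mul_self_nonneg (x i)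

lemma dotProduct_self_pos {x : ι → ℝ} (hx : x ≠ 0) : 0 < x ⬝ᵥ x :=
  (dotProduct_self_nonneg x).lt_of_ne' fun h => hx (dotProduct_self_eq_zero.1 h)

lemma mulVec_dotProduct_mulVec (M : Matrix ι κ ℝ) (x : κ → ℝ) (N : Matrix ι μ ℝ) (y : μ → ℝ) :
    (M *ᵥ x) ⬝ᵥ (N *ᵥ y) = x ⬝ᵥ ((Mᵀ * N) *ᵥ y) := by
  rw [← Matrix.mulVec_mulVec, Matrix.dotProduct_mulVec x, Matrix.vecMul_transpose]

/-- Squared form of the bound of `M x` by the operator norm. -/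
lemma mulVec_sq_le (M : Matrix ι κ ℝ) (x : κ → ℝ) :
    (M *ᵥ x) ⬝ᵥ (M *ᵥ x) ≤ ‖M‖ ^ 2 * (x ⬝ᵥ x) := by
  rw [← norm_toLp_sq, ← norm_toLp_sq, ← mul_pow]
  exact pow_le_pow_left₀ (norm_nonneg _) (Matrix.l2_opNorm_mulVec M (WithLp.toLp 2 x)) 2

lemma norm_le_of_mulVec_sq_le (M : Matrix ι κ ℝ) {c : ℝ} (hc : 0 ≤ c)
    (h : ∀ x, (M *ᵥ x) ⬝ᵥ (M *ᵥ x) ≤ c ^ 2 * (x ⬝ᵥ x)) : ‖M‖ ≤ c := by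
  rw [Matrix.l2_opNorm_def]
  refine ContinuousLinearMap.opNorm_le_bound _ hc fun x => ?_
  have h1 := h x.ofLp
  rw [← norm_toLp_sq, ← norm_toLp_sq, ← mul_pow] at h1
  exact le_of_sq_le_sq h1 (by positivity)

lemma norm_sq_le_of_mulVec_sq_le (M : Matrix ι κ ℝ) {c : ℝ} (hc : 0 ≤ c)
    (h : ∀ x, (M *ᵥ x) ⬝ᵥ (M *ᵥ x) ≤ c * (x ⬝ᵥ x)) : ‖M‖ ^ 2 ≤ c := by
  have := norm_le_of_mulVec_sq_le M (Real.sqrt_nonneg c) (by simpa [Real.sq_sqrt hc] using h)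
  calc ‖M‖ ^ 2 ≤ √c ^ 2 := pow_le_pow_left₀ (norm_nonneg _) this 2
    _ = c := Real.sq_sqrt hc

lemma norm_transpose (M : Matrix ι κ ℝ) : ‖Mᵀ‖ = ‖M‖ := by
  rw [← Matrix.conjTranspose_eq_transpose_of_trivial, Matrix.l2_opNorm_conjTranspose]

lemma dotProduct_comp_le (x : ι → ℝ) {f : κ → ι} (hf : Function.Injective f) :
    (x ∘ f) ⬝ᵥ (x ∘ f) ≤ x ⬝ᵥ x := by
  have : (x ∘ f) ⬝ᵥ (x ∘ f) = ∑ i ∈ Finset.univ.map ⟨f, hf⟩, x i * x i := by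
    simp [dotProduct]
  rw [this]
  exact Finset.sum_le_sum_of_subset_of_nonneg (Finset.subset_univ _)
    fun i _ _ => mul_self_nonneg (x i)

lemma norm_submatrix_rows_le (M : Matrix ι κ ℝ) {f : μ → ι} (hf : Function.Injective f) :
    ‖M.submatrix f id‖ ≤ ‖M‖ :=
  norm_le_of_mulVec_sq_le _ (norm_nonneg _) fun x =>
    (dotProduct_comp_le (M *ᵥ x) hf).trans (mulVec_sq_le M x)

lemma norm_submatrix_cols_le (M : Matrix ι κ ℝ) {f : μ → κ} (hf : Function.Injective f) :
    ‖M.submatrix id f‖ ≤ ‖M‖ := by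
  rw [← norm_transpose, ← norm_transpose M]
  exact norm_submatrix_rows_le Mᵀ hf

lemma trace_transpose_mul_self (M : Matrix ι κ ℝ) : (Mᵀ * M).trace = ∑ i, ∑ j, M i j ^ 2 := by
  rw [Finset.sum_comm]
  simp [Matrix.trace, Matrix.mul_apply, sq]

lemma trace_transpose_mul_self_nonneg (M : Matrix ι κ ℝ) : 0 ≤ (Mᵀ * M).trace := by
  rw [trace_transpose_mul_self]; positivity

lemma norm_sq_le_trace (M : Matrix ι κ ℝ) : ‖M‖ ^ 2 ≤ (Mᵀ * M).trace := by
  refine norm_sq_le_of_mulVec_sq_le _ (trace_transpose_mul_self_nonneg M) fun x => ?_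
  rw [trace_transpose_mul_self, Finset.sum_mul]
  refine Finset.sum_le_sum fun i _ => ?_
  have := Finset.sum_mul_sq_le_sq_mul_sq Finset.univ (M i) x
  simpa [Matrix.mulVec, dotProduct, sq] using this

lemma trace_le_card_mul (M : Matrix ι κ ℝ) {c : ℝ}
    (h : ∀ x, (M *ᵥ x) ⬝ᵥ (M *ᵥ x) ≤ c * (x ⬝ᵥ x)) :
    (Mᵀ * M).trace ≤ Fintype.card κ * c := by
  have h1 : ∀ j, (Mᵀ * M) j j ≤ c := fun j => by
    have := h (Pi.single j 1)
    simpa [Matrix.mulVec_single_one, Matrix.mul_apply, dotProduct, Matrix.col, Pi.single_apply]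
      using this
  calc (Mᵀ * M).trace ≤ ∑ _j : κ, c := Finset.sum_le_sum fun j _ => h1 j
    _ = Fintype.card κ * c := by simp

lemma trace_transpose_mul_self_le (M : Matrix ι κ ℝ) :
    (Mᵀ * M).trace ≤ Fintype.card κ * ‖M‖ ^ 2 :=
  trace_le_card_mul M (mulVec_sq_le M)

lemma norm_le_one_of_isSymm_of_mul_self {M : Matrix ι ι ℝ} (hs : Mᵀ = M) (h : M * M = M) :
    ‖M‖ ≤ 1 := by
  have h1 := Matrix.l2_opNorm_conjTranspose_mul_self M
  rw [Matrix.conjTranspose_eq_transpose_of_trivial, hs, h] at h1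
  by_contra hlt
  nlinarith [norm_nonneg M]

lemma norm_le_one_of_transpose_mul_self {M : Matrix ι κ ℝ} (h : Mᵀ * M = 1) : ‖M‖ ≤ 1 := by
  refine norm_le_of_mulVec_sq_le _ zero_le_one fun x => ?_
  rw [mulVec_dotProduct_mulVec, h]; simp

/-- An injective linear map on a finite-dimensional space is bounded below. -/
lemma exists_pos_mul_le_mulVec_sq (M : Matrix ι κ ℝ) (h : ∀ x, M *ᵥ x = 0 → x = 0) :
    ∃ w : ℝ, 0 < w ∧ ∀ x, w * (x ⬝ᵥ x) ≤ (M *ᵥ x) ⬝ᵥ (M *ᵥ x) := by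
  let T := LinearMap.toContinuousLinearMap (Matrix.toEuclideanLin M)
  have hker : (T : EuclideanSpace ℝ κ →ₗ[ℝ] EuclideanSpace ℝ ι).ker = ⊥ := by
    refine LinearMap.ker_eq_bot'.2 fun x hx => ?_
    have : M *ᵥ x.ofLp = 0 := congrArg WithLp.ofLp hx
    exact WithLp.ofLp_injective _ (h _ this)
  obtain ⟨K, hK, hT⟩ := LinearMap.exists_antilipschitzWith _ hker
  refine ⟨((K : ℝ) ^ 2)⁻¹, by positivity, fun x => ?_⟩
  have h1 := ZeroHomClass.bound_of_antilipschitz (T : EuclideanSpace ℝ κ →ₗ[ℝ] EuclideanSpace ℝ ι)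
    hT (WithLp.toLp 2 x)
  have h2 : ‖(WithLp.toLp 2 x : EuclideanSpace ℝ κ)‖
      ≤ K * ‖(WithLp.toLp 2 (M *ᵥ x) : EuclideanSpace ℝ ι)‖ := h1
  have h3 := pow_le_pow_left₀ (norm_nonneg _) h2 2
  rw [mul_pow, norm_toLp_sq, norm_toLp_sq] at h3
  have : (0 : ℝ) < (K : ℝ) ^ 2 := by positivity
  rw [inv_mul_le_iff₀ this]
  exact h3

lemma mulVec_eq_zero_of_rank_eq_card {M : Matrix ι κ ℝ} (h : M.rank = Fintype.card κ) (x : κ → ℝ)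
    (hx : M *ᵥ x = 0) : x = 0 := by
  have h1 := M.mulVecLin.finrank_range_add_finrank_ker
  rw [← Matrix.rank, h, Module.finrank_fintype_fun_eq_card] at h1
  have h2 : M.mulVecLin.ker = ⊥ := Submodule.finrank_eq_zero.1 (by omega)
  exact LinearMap.ker_eq_bot'.1 h2 x hx

lemma rank_eq_card_of_mulVec_injective {M : Matrix ι κ ℝ} (h : ∀ x, M *ᵥ x = 0 → x = 0) :
    M.rank = Fintype.card κ := by
  have h1 := M.mulVecLin.finrank_range_add_finrank_ker
  rw [LinearMap.ker_eq_bot'.2 h, finrank_bot, Module.finrank_fintype_fun_eq_card] at h1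
  simpa [Matrix.rank] using h1

/-- Existence part of the polar decomposition of a real square matrix. -/
lemma exists_orthogonal_posSemidef (M : Matrix ι ι ℝ) :
    ∃ Q ∈ Matrix.orthogonalGroup ι ℝ, (Qᵀ * M).PosSemidef := by
  have hH : (Mᵀ * M).IsHermitian := by
    simpa using Matrix.isHermitian_conjTranspose_mul_self M
  have hP : (Mᵀ * M).PosSemidef := by simpa using Matrix.posSemidef_conjTranspose_mul_self M
  have hev : ∀ i, (Mᵀ * M) *ᵥ (hH.eigenvectorBasis i).ofLp
      = hH.eigenvalues i • (hH.eigenvectorBasis i).ofLp := hH.mulVec_eigenvectorBasis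
  have hnn := hP.eigenvalues_nonneg
  set v := hH.eigenvectorBasis
  set l := hH.eigenvalues
  have hvv : ∀ i j, (v i).ofLp ⬝ᵥ (v j).ofLp = if i = j then 1 else 0 := fun i j => by
    have := orthonormal_iff_ite.1 v.orthonormal i j
    rw [← this]
    simp [PiLp.inner_apply, dotProduct, mul_comm]
  have hMM : ∀ i j, (M *ᵥ (v i).ofLp) ⬝ᵥ (M *ᵥ (v j).ofLp) = if i = j then l i else 0 := by
    intro i j
    rw [mulVec_dotProduct_mulVec, hev, dotProduct_smul, hvv]
    split_ifs with hij <;> simp [hij]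
  -- The images `M v i` are orthogonal with squared lengths `l i`. The nonzero ones are normalized
  -- and completed to an orthonormal basis, so that singular `M` is covered too.
  let s : Set ι := {i | l i ≠ 0}
  let w : ι → EuclideanSpace ℝ ι := fun i => WithLp.toLp 2 ((√(l i))⁻¹ • (M *ᵥ (v i).ofLp))
  have hw : Orthonormal ℝ (s.domRestrict w) := by
    rw [orthonormal_iff_ite]
    rintro ⟨i, hi⟩ ⟨j, hj⟩
    have h1 : inner ℝ (w i) (w j) = (√(l i))⁻¹ * ((√(l j))⁻¹ *
        ((M *ᵥ (v i).ofLp) ⬝ᵥ (M *ᵥ (v j).ofLp))) := by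
      simp only [w, PiLp.inner_apply, dotProduct, Finset.mul_sum]
      refine Finset.sum_congr rfl fun a _ => ?_
      simp; ring
    change inner ℝ (w i) (w j) = _
    simp only [h1, hMM, Subtype.mk.injEq]
    split_ifs with hij
    · subst hij
      have : 0 < √(l i) := Real.sqrt_pos.2 ((hnn i).lt_of_ne' hi)
      field_simp
      exact (Real.sq_sqrt (hnn i)).symm
    · simp
  obtain ⟨b, hb⟩ := hw.exists_orthonormalBasis_extension_of_card_eq (by simp)
  have hMv : ∀ i, M *ᵥ (v i).ofLp = √(l i) • (b i).ofLp := fun i => by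
    by_cases hi : l i = 0
    · have := hMM i i
      rw [if_pos rfl, hi] at this
      rw [dotProduct_self_eq_zero.1 this, hi]; simp
    · rw [hb i hi]
      have : 0 < √(l i) := Real.sqrt_pos.2 ((hnn i).lt_of_ne' hi)
      simp [w, smul_smul, this.ne']
  let V : Matrix ι ι ℝ := Matrix.of fun a i => v i a
  let W : Matrix ι ι ℝ := Matrix.of fun a i => b i a
  have hV : Vᵀ * V = 1 := by
    ext i j
    simpa [V, Matrix.mul_apply, dotProduct, Matrix.one_apply] using hvv i j
  have hW : Wᵀ * W = 1 := by
    ext i j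
    have := orthonormal_iff_ite.1 b.orthonormal i j
    rw [Matrix.one_apply, ← this]
    simp [W, Matrix.mul_apply, PiLp.inner_apply, mul_comm]
  have hV' : V * Vᵀ = 1 := mul_eq_one_comm.1 hV
  have hMV : M * V = W * Matrix.diagonal (fun i => √(l i)) := by
    ext a i
    have := congrFun (hMv i) a
    rw [Matrix.mul_diagonal]
    simpa [V, W, Matrix.mul_apply, Matrix.mulVec, dotProduct, mul_comm] using this
  refine ⟨W * Vᵀ, ?_, ?_⟩
  · rw [Matrix.mem_orthogonalGroup_iff', Matrix.transpose_mul, Matrix.transpose_transpose,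
      Matrix.mul_assoc, ← Matrix.mul_assoc Wᵀ, hW, Matrix.one_mul, hV']
  · have h1 : (W * Vᵀ)ᵀ * M = V * Matrix.diagonal (fun i => √(l i)) * Vᵀ := by
      calc (W * Vᵀ)ᵀ * M = V * Wᵀ * (M * V) * Vᵀ := by
            rw [Matrix.mul_assoc (V * Wᵀ), Matrix.mul_assoc M, hV', Matrix.mul_one,
              Matrix.transpose_mul, Matrix.transpose_transpose]
        _ = V * (Wᵀ * W) * Matrix.diagonal (fun i => √(l i)) * Vᵀ := by
            rw [hMV]; simp only [Matrix.mul_assoc]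
        _ = _ := by rw [hW, Matrix.mul_one]
    rw [h1]
    have := (Matrix.PosSemidef.diagonal (d := fun i => √(l i))
      (fun i => Real.sqrt_nonneg _)).mul_mul_conjTranspose_same V
    simpa using this

/-- In an eigenbasis of `T* T` with eigenvalues `l i`, the two squared norms are the sums of `l i *
x i ^ 2` and of `(l i * x i) ^ 2`. Every eigenvalue is either zero or at least the square of the
last nonzero singular value, whose zero-based index is the rank minus one. -/
lemma sq_singularValues_mul_norm_sq_le {E F : Type*} [NormedAddCommGroup E] [InnerProductSpace ℝ E]
    [FiniteDimensional ℝ E] [NormedAddCommGroup F] [InnerProductSpace ℝ F] [FiniteDimensional ℝ F]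
    (T : E →ₗ[ℝ] F) (x : E) :
    T.singularValues (Module.finrank ℝ T.range - 1) ^ 2 * ‖T x‖ ^ 2
      ≤ ‖LinearMap.adjoint T (T x)‖ ^ 2 := by
  have hA := T.isSymmetric_adjoint_comp_self
  set b := hA.eigenvectorBasis rfl with hb
  have hrepr : ∀ i, b.repr (LinearMap.adjoint T (T x)) i = hA.eigenvalues rfl i * b.repr x i :=
    fun i => by
      simpa using hA.eigenvectorBasis_apply_self_apply rfl x i
  have h1 : ‖LinearMap.adjoint T (T x)‖ ^ 2 = ∑ i, (hA.eigenvalues rfl i * b.repr x i) ^ 2 := by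
    rw [← b.repr.norm_map, EuclideanSpace.norm_sq_eq]
    simp only [hrepr, Real.norm_eq_abs, sq_abs]
  have h2 : ‖T x‖ ^ 2 = ∑ i, hA.eigenvalues rfl i * b.repr x i ^ 2 := by
    rw [← real_inner_self_eq_norm_sq, ← LinearMap.adjoint_inner_left,
      ← b.repr.inner_map_map, PiLp.inner_apply]
    refine Finset.sum_congr rfl fun i _ => ?_
    rw [hrepr]; simp; ring
  rw [h1, h2, Finset.mul_sum]
  refine Finset.sum_le_sum fun i _ => ?_
  have hsq := T.sq_singularValues_fin rfl i
  by_cases hi : (i : ℕ) < Module.finrank ℝ T.range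
  · have hle : T.singularValues (Module.finrank ℝ T.range - 1) ≤ T.singularValues i :=
      T.singularValues_antitone (by omega)
    have hle2 := pow_le_pow_left₀ (T.singularValues_nonneg _) hle 2
    rw [hsq] at hle2
    have h0 : 0 ≤ hA.eigenvalues rfl i := by rw [← hsq]; positivity
    have := mul_le_mul_of_nonneg_right hle2 (mul_nonneg h0 (sq_nonneg (b.repr x i)))
    linarith
  · have h0 := T.singularValues_eq_zero_iff_le_finrank_range.2 (not_lt.1 hi)
    rw [h0] at hsq
    rw [← hsq]; simp

lemma finrank_range_toEuclideanLin (M : Matrix ι κ ℝ) :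
    Module.finrank ℝ (Matrix.toEuclideanLin M).range = M.rank := by
  rw [Matrix.rank_eq_finrank_range_toLin M (PiLp.basisFun 2 ℝ ι) (PiLp.basisFun 2 ℝ κ)]
  rfl

/-- On the range of a matrix of rank `n`, its transpose expands by at least the `n`-th largest
singular value. -/
lemma sigma_sq_mul_le {n : ℕ} {M : Matrix ι κ ℝ} (hM : M.rank = n) (x : κ → ℝ) :
    sigma n M ^ 2 * ((M *ᵥ x) ⬝ᵥ (M *ᵥ x)) ≤ (Mᵀ *ᵥ (M *ᵥ x)) ⬝ᵥ (Mᵀ *ᵥ (M *ᵥ x)) := by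
  have h := sq_singularValues_mul_norm_sq_le (Matrix.toEuclideanLin M) (WithLp.toLp 2 x)
  rw [finrank_range_toEuclideanLin, hM, ← Matrix.toEuclideanLin_conjTranspose_eq_adjoint,
    Matrix.conjTranspose_eq_transpose_of_trivial] at h
  rw [← norm_toLp_sq, ← norm_toLp_sq]
  exact h

lemma sigma_pos {n : ℕ} (hn : 0 < n) {M : Matrix ι κ ℝ} (hM : M.rank = n) : 0 < sigma n M := by
  rw [sigma, LinearMap.singularValues_pos_iff_lt_finrank_range, finrank_range_toEuclideanLin, hM]
  omega

lemma sigma_le_norm {n : ℕ} (hn : 0 < n) {M : Matrix ι κ ℝ} (hM : M.rank = n) :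
    sigma n M ≤ ‖M‖ := by
  have hne : M ≠ 0 := fun h => by simp [h] at hM; omega
  obtain ⟨x, hx⟩ : ∃ x, M *ᵥ x ≠ 0 := by
    by_contra! h
    exact hne (Matrix.ext_of_mulVec_single fun i => by rw [h, Matrix.zero_mulVec])
  have h1 := (sigma_sq_mul_le hM x).trans (mulVec_sq_le Mᵀ _)
  rw [norm_transpose] at h1
  exact le_of_sq_le_sq (le_of_mul_le_mul_right h1 (dotProduct_self_pos hx)) (norm_nonneg _)

end Norms

/-! ### Perturbation of truncated singular value decompositions and of balanced factorizations. -/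

section Perturbation

variable {ι κ μ : Type*} [Fintype ι] [Fintype κ] [Fintype μ]
  [DecidableEq ι] [DecidableEq κ] [DecidableEq μ] {n : ℕ}

lemma mulVec_sq_eq_of_transpose_mul_self {U : Matrix ι κ ℝ} (hU : Uᵀ * U = 1) (x : κ → ℝ) :
    (U *ᵥ x) ⬝ᵥ (U *ᵥ x) = x ⬝ᵥ x := by
  rw [mulVec_dotProduct_mulVec, hU, Matrix.one_mulVec]

lemma mul_le_diagonal_mulVec_sq {s : κ → ℝ} {c : ℝ} (hc : 0 ≤ c) (h : ∀ i, c ≤ s i) (x : κ → ℝ) :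
    c ^ 2 * (x ⬝ᵥ x) ≤ (Matrix.diagonal s *ᵥ x) ⬝ᵥ (Matrix.diagonal s *ᵥ x) := by
  simp only [dotProduct, Matrix.mulVec_diagonal, Finset.mul_sum]
  refine Finset.sum_le_sum fun i _ => ?_
  have := mul_le_mul_of_nonneg_right (pow_le_pow_left₀ hc (h i) 2) (mul_self_nonneg (x i))
  linarith

lemma norm_diagonal_le {s : κ → ℝ} {c : ℝ} (hc : 0 ≤ c) (h : ∀ i, |s i| ≤ c) :
    ‖Matrix.diagonal s‖ ≤ c := by
  rw [Matrix.l2_opNorm_diagonal]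
  exact (pi_norm_le_iff_of_nonneg hc).2 h

lemma norm_mul_mul_le_of_orthonormal {ν : Type*} [Fintype ν] [DecidableEq ν]
    {U : Matrix ι μ ℝ} {V : Matrix κ ν ℝ} (hU : Uᵀ * U = 1) (hV : Vᵀ * V = 1) (D : Matrix μ ν ℝ) :
    ‖U * D * Vᵀ‖ ≤ ‖D‖ := by
  have hU' := norm_le_one_of_transpose_mul_self hU
  have hV' := norm_le_one_of_transpose_mul_self hV
  rw [← norm_transpose] at hV'
  calc ‖U * D * Vᵀ‖ ≤ ‖U * D‖ * ‖Vᵀ‖ := Matrix.l2_opNorm_mul _ _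
    _ ≤ ‖U‖ * ‖D‖ * 1 := by gcongr; exact Matrix.l2_opNorm_mul _ _
    _ ≤ 1 * ‖D‖ * 1 := by gcongr
    _ = ‖D‖ := by ring

lemma transpose_mul_self_submatrix {W : Matrix ι κ ℝ} {e : μ → κ} (he : Function.Injective e)
    (hW : Wᵀ * W = 1) : (W.submatrix id e)ᵀ * W.submatrix id e = 1 := by
  ext i j
  have := congrFun (congrFun hW (e i)) (e j)
  simpa [Matrix.mul_apply, Matrix.one_apply, he.eq_iff] using this

/-- The singular values beyond the `n`-th are at most the distance to any matrix of rank at most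
`n`. -/
lemma IsSVD.le_norm_sub {r : ℕ} {M : Matrix ι κ ℝ} {U : Matrix ι (Fin r) ℝ} {s : Fin r → ℝ}
    {V : Matrix κ (Fin r) ℝ} (hM : IsSVD M U s V) (X : Matrix ι (Fin n) ℝ)
    (Y : Matrix (Fin n) κ ℝ) (hn : n < r) : s ⟨n, hn⟩ ≤ ‖M - X * Y‖ := by
  let e : Fin (n + 1) → Fin r := Fin.castLE hn
  have he : Function.Injective e := Fin.castLE_injective hn
  have hU' := transpose_mul_self_submatrix he hM.orthU
  have hV' := transpose_mul_self_submatrix he hM.orthV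
  have hMV : M * V.submatrix id e = U.submatrix id e * Matrix.diagonal (s ∘ e) := by
    have h1 : M * V = U * Matrix.diagonal s := by
      rw [hM.eq, Matrix.mul_assoc, hM.orthV, Matrix.mul_one]
    ext i j
    have := congrFun (congrFun h1 i) (e j)
    rw [Matrix.mul_diagonal] at this ⊢
    exact this
  -- By dimension count, some combination of the top `n + 1` right singular vectors is killed by
  -- `Y`; on it `M - X * Y` agrees with `M`, which expands by at least `s n`.
  obtain ⟨c, hc, hc0⟩ : ∃ c : Fin (n + 1) → ℝ, (Y * V.submatrix id e) *ᵥ c = 0 ∧ c ≠ 0 := by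
    have := LinearMap.ker_ne_bot_of_finrank_lt (f := (Y * V.submatrix id e).mulVecLin)
      (by simp)
    obtain ⟨c, hc, hc0⟩ := (Submodule.ne_bot_iff _).1 this
    exact ⟨c, hc, hc0⟩
  have h1 : (M - X * Y) *ᵥ (V.submatrix id e *ᵥ c)
      = U.submatrix id e *ᵥ (Matrix.diagonal (s ∘ e) *ᵥ c) := by
    rw [Matrix.sub_mulVec, Matrix.mulVec_mulVec, hMV, Matrix.mulVec_mulVec, Matrix.mulVec_mulVec,
      Matrix.mul_assoc X, ← Matrix.mulVec_mulVec _ X, hc]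
    simp
  have h2 := mulVec_sq_le (M - X * Y) (V.submatrix id e *ᵥ c)
  rw [h1, mulVec_sq_eq_of_transpose_mul_self hU', mulVec_sq_eq_of_transpose_mul_self hV'] at h2
  have h3 := mul_le_diagonal_mulVec_sq (s := s ∘ e) (hM.nonneg ⟨n, hn⟩)
    (fun i => hM.anti (by simp [Fin.le_def, e]; omega)) c
  exact le_of_sq_le_sq (le_of_mul_le_mul_right (h3.trans h2) (dotProduct_self_pos hc0))
    (norm_nonneg _)

lemma IsTruncation.norm_sub_le {M N : Matrix ι κ ℝ} (h : IsTruncation n M N)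
    (X : Matrix ι (Fin n) ℝ) (Y : Matrix (Fin n) κ ℝ) : ‖M - N‖ ≤ ‖M - X * Y‖ := by
  obtain ⟨r, U, s, V, hM, rfl⟩ := h
  have h1 : M - U * Matrix.diagonal (fun i : Fin r => if (i : ℕ) < n then s i else 0) * Vᵀ
      = U * Matrix.diagonal (fun i : Fin r => if (i : ℕ) < n then 0 else s i) * Vᵀ := by
    nth_rewrite 1 [hM.eq]
    rw [← Matrix.sub_mul, ← Matrix.mul_sub, Matrix.diagonal_sub]
    congr 3
    ext i; split_ifs <;> simp
  rw [h1]
  refine (norm_mul_mul_le_of_orthonormal hM.orthU hM.orthV _).trans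
    (norm_diagonal_le (norm_nonneg _) fun i => ?_)
  split_ifs with hi
  · simp
  · rw [abs_of_nonneg (hM.nonneg i)]
    have hlt : n < r := (not_lt.1 hi).trans_lt i.2
    exact (hM.anti (show (⟨n, hlt⟩ : Fin r) ≤ i from not_lt.1 hi)).trans (hM.le_norm_sub X Y hlt)

/-- The kept and the discarded singular directions are orthogonal. -/
lemma IsTruncation.transpose_mul_sub {M N : Matrix ι κ ℝ} (h : IsTruncation n M N) :
    Nᵀ * (M - N) = 0 := by
  obtain ⟨r, U, s, V, hM, rfl⟩ := h
  set d := fun i : Fin r => if (i : ℕ) < n then s i else 0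
  have h1 : M - U * Matrix.diagonal d * Vᵀ = U * Matrix.diagonal (s - d) * Vᵀ := by
    nth_rewrite 1 [hM.eq]
    rw [← Matrix.sub_mul, ← Matrix.mul_sub, Matrix.diagonal_sub]; rfl
  rw [h1, Matrix.transpose_mul, Matrix.transpose_mul, Matrix.transpose_transpose,
    Matrix.diagonal_transpose]
  calc V * (Matrix.diagonal d * Uᵀ) * (U * Matrix.diagonal (s - d) * Vᵀ)
      = V * (Matrix.diagonal d * (Uᵀ * U) * Matrix.diagonal (s - d)) * Vᵀ := by
        simp only [Matrix.mul_assoc]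
    _ = 0 := by
        rw [hM.orthU, Matrix.mul_one, Matrix.diagonal_mul_diagonal]
        have : (fun i => d i * (s - d) i) = 0 := by
          ext i; simp only [d, Pi.sub_apply]; split_ifs <;> simp
        rw [this]; simp

lemma IsTruncation.eq_of_eq_mul {M N : Matrix ι κ ℝ} (h : IsTruncation n M N)
    {X : Matrix ι (Fin n) ℝ} {Y : Matrix (Fin n) κ ℝ} (hM : M = X * Y) : N = M := by
  have := h.norm_sub_le X Y
  rw [← hM, sub_self, norm_zero] at this
  exact (sub_eq_zero.1 (norm_le_zero_iff.1 this)).symm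

lemma IsSVD.mul_right {r : ℕ} {M : Matrix ι κ ℝ} {U : Matrix ι (Fin r) ℝ} {s : Fin r → ℝ}
    {V : Matrix κ (Fin r) ℝ} (hM : IsSVD M U s V) : M * V = U * Matrix.diagonal s := by
  rw [hM.eq, Matrix.mul_assoc, hM.orthV, Matrix.mul_one]

/-- Euclidean norm of a plain vector. -/
abbrev vecNorm (x : ι → ℝ) : ℝ := ‖(WithLp.toLp 2 x : EuclideanSpace ℝ ι)‖

/-- Weyl's inequality for the singular values of matrices of rank `n`. -/
lemma IsSVD.sub_norm_le {N N' : Matrix ι κ ℝ} {U U' : Matrix ι (Fin n) ℝ} {s s' : Fin n → ℝ}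
    {V V' : Matrix κ (Fin n) ℝ} (h : IsSVD N U s V) (h' : IsSVD N' U' s' V') {τ : ℝ}
    (hs : ∀ i, τ ≤ s i) (hlt : ‖N' - N‖ < τ) (i : Fin n) : τ - ‖N' - N‖ ≤ s' i := by
  have hτ : 0 < τ := (norm_nonneg _).trans_lt hlt
  let K := V'ᵀ * V
  have hV : ∀ x, vecNorm (V *ᵥ x) = vecNorm x := fun x => by
    have := mulVec_sq_eq_of_transpose_mul_self h.orthV x
    rw [← norm_toLp_sq, ← norm_toLp_sq] at this
    exact (pow_left_inj₀ (norm_nonneg _) (norm_nonneg _) two_ne_zero).1 this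
  have hlow : ∀ x, (τ - ‖N' - N‖) * vecNorm x ≤ vecNorm (Matrix.diagonal s' *ᵥ (K *ᵥ x)) := by
    intro x
    have h1 : τ * vecNorm x ≤ vecNorm (N *ᵥ (V *ᵥ x)) := by
      refine le_of_sq_le_sq ?_ (norm_nonneg _)
      rw [mul_pow, norm_toLp_sq, norm_toLp_sq, Matrix.mulVec_mulVec, h.mul_right,
        ← Matrix.mulVec_mulVec, mulVec_sq_eq_of_transpose_mul_self h.orthU]
      exact mul_le_diagonal_mulVec_sq hτ.le hs x
    have h2 : vecNorm ((N' - N) *ᵥ (V *ᵥ x)) ≤ ‖N' - N‖ * vecNorm x := by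
      rw [← hV x]
      exact Matrix.l2_opNorm_mulVec (N' - N) (WithLp.toLp 2 (V *ᵥ x))
    have h3 : vecNorm (N *ᵥ (V *ᵥ x)) ≤ vecNorm (N' *ᵥ (V *ᵥ x)) + vecNorm ((N' - N) *ᵥ (V *ᵥ x)) := by
      have : N *ᵥ (V *ᵥ x) = N' *ᵥ (V *ᵥ x) - (N' - N) *ᵥ (V *ᵥ x) := by
        rw [Matrix.sub_mulVec]; abel
      rw [this]
      exact norm_sub_le (WithLp.toLp 2 (N' *ᵥ (V *ᵥ x))) (WithLp.toLp 2 ((N' - N) *ᵥ (V *ᵥ x)))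
    have h4 : vecNorm (N' *ᵥ (V *ᵥ x)) = vecNorm (Matrix.diagonal s' *ᵥ (K *ᵥ x)) := by
      refine (pow_left_inj₀ (norm_nonneg _) (norm_nonneg _) two_ne_zero).1 ?_
      rw [norm_toLp_sq, norm_toLp_sq, h'.eq, Matrix.mulVec_mulVec, Matrix.mul_assoc,
        Matrix.mul_assoc, ← Matrix.mulVec_mulVec, mulVec_sq_eq_of_transpose_mul_self h'.orthU,
        Matrix.mulVec_mulVec]
    linarith
  -- By `hlow` the square matrix `K` is injective, hence onto. A preimage `x` of the `i`-th basis
  -- vector has norm at least 1 because `K` is a contraction, and evaluating `hlow` at this `x`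
  -- isolates `s' i`.
  have hinj : Function.Injective K.mulVecLin := by
    refine LinearMap.ker_eq_bot.1 (LinearMap.ker_eq_bot'.2 fun x hx => ?_)
    have h1 := hlow x
    have h2 : K *ᵥ x = 0 := hx
    rw [h2, Matrix.mulVec_zero] at h1
    have h3 : vecNorm (0 : Fin n → ℝ) = 0 := by simp [vecNorm]
    have h4 : vecNorm x ≤ 0 := by
      rw [h3] at h1
      exact nonpos_of_mul_nonpos_right h1 (sub_pos.2 hlt)
    simpa [vecNorm] using h4
  obtain ⟨x, hx⟩ := LinearMap.surjective_of_injective hinj (Pi.single i 1)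
  have hx : K *ᵥ x = Pi.single i 1 := hx
  have hK : ‖K‖ ≤ 1 := by
    have h1 := norm_le_one_of_transpose_mul_self h.orthV
    have h2 := norm_le_one_of_transpose_mul_self h'.orthV
    rw [← norm_transpose] at h2
    exact (Matrix.l2_opNorm_mul _ _).trans (mul_le_one₀ h2 (norm_nonneg _) h1)
  have h1 : 1 ≤ vecNorm x := by
    have h2 : vecNorm (K *ᵥ x) ≤ ‖K‖ * vecNorm x := Matrix.l2_opNorm_mulVec K (WithLp.toLp 2 x)
    have h3 : vecNorm (K *ᵥ x) = 1 := by rw [hx]; simp [vecNorm]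
    rw [h3] at h2
    exact h2.trans (mul_le_of_le_one_left (norm_nonneg _) hK)
  have h2 := hlow x
  have h3 : Matrix.diagonal s' *ᵥ (K *ᵥ x) = Pi.single i (s' i) := by
    rw [hx]; ext j
    rw [Matrix.mulVec_diagonal]
    by_cases hj : j = i
    · subst hj; simp
    · simp [hj]
  have h4 : vecNorm (Pi.single i (s' i)) = s' i := by
    simp [vecNorm, abs_of_nonneg (h'.nonneg i)]
  rw [h3, h4] at h2
  exact (le_mul_of_one_le_right (sub_pos.2 hlt).le h1).trans h2

/-- Frobenius distance between the rank-`n` truncation of a perturbed matrix and the original. -/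
lemma IsSVD.trace_sub_le {N N' M' : Matrix ι κ ℝ} {U U' : Matrix ι (Fin n) ℝ} {s s' : Fin n → ℝ}
    {V V' : Matrix κ (Fin n) ℝ} (h : IsSVD N U s V) (h' : IsSVD N' U' s' V')
    (hs' : ∀ i, 0 < s' i) {ε : ℝ} (hε : ‖M' - N‖ ≤ ε) (hε' : ‖M' - N'‖ ≤ ε)
    (hort : N'ᵀ * (M' - N') = 0) :
    ((N' - N)ᵀ * (N' - N)).trace ≤ 5 * n * ε ^ 2 := by
  -- Positivity of `s'` allows `V'` and `diagonal s'` to be cancelled from `hort`.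
  have hUM : U'ᵀ * (M' - N') = 0 := by
    have hD : Matrix.diagonal (fun i => (s' i)⁻¹) * Matrix.diagonal s' = 1 := by
      rw [Matrix.diagonal_mul_diagonal, ← Matrix.diagonal_one]
      congr 1; ext i; exact inv_mul_cancel₀ (hs' i).ne'
    have h1 : N'ᵀ = V' * (Matrix.diagonal s' * U'ᵀ) := by
      rw [h'.eq]; simp [Matrix.transpose_mul]
    calc U'ᵀ * (M' - N') = (Matrix.diagonal (fun i => (s' i)⁻¹) * Matrix.diagonal s') *
          (U'ᵀ * (M' - N')) := by rw [hD, Matrix.one_mul]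
      _ = Matrix.diagonal (fun i => (s' i)⁻¹) * ((V'ᵀ * V') *
          (Matrix.diagonal s' * (U'ᵀ * (M' - N')))) := by
            rw [h'.orthV, Matrix.one_mul, Matrix.mul_assoc]
      _ = Matrix.diagonal (fun i => (s' i)⁻¹) * (V'ᵀ * (N'ᵀ * (M' - N'))) := by
            rw [h1]; simp only [Matrix.mul_assoc]
      _ = 0 := by rw [hort]; simp
  have hε0 : 0 ≤ ε := (norm_nonneg _).trans hε
  set X := N' - N with hX
  have hXn : ‖X‖ ≤ 2 * ε := by
    have : X = (M' - N) - (M' - N') := by rw [hX]; abel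
    rw [this]; linarith [norm_sub_le (M' - N) (M' - N')]
  set P := U' * U'ᵀ with hP
  have hPt : Pᵀ = P := by rw [hP]; simp
  have hPP : P * P = P := by
    rw [hP, Matrix.mul_assoc, ← Matrix.mul_assoc U'ᵀ, h'.orthU, Matrix.one_mul]
  have hPc : (1 - P)ᵀ = 1 - P := by rw [Matrix.transpose_sub, hPt, Matrix.transpose_one]
  have hPPc : (1 - P) * (1 - P) = 1 - P := by
    rw [Matrix.sub_mul, Matrix.mul_sub, Matrix.mul_sub, hPP]; simp
  have hPn := norm_le_one_of_isSymm_of_mul_self hPc hPPc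
  have hPN' : (1 - P) * N' = 0 := by
    have : P * N' = N' := by
      rw [hP, h'.eq, ← Matrix.mul_assoc, ← Matrix.mul_assoc, Matrix.mul_assoc U' U'ᵀ U', h'.orthU,
        Matrix.mul_one]
    rw [Matrix.sub_mul, this, Matrix.one_mul, sub_self]
  -- Pythagoras for the projection `P` onto the columns of `U'`. Each part factors through `n`
  -- dimensions, so its squared Frobenius norm is at most `n` times its squared spectral norm; the
  -- two give `n ε²` and `n (2ε)²`, in all `5 n ε²`.
  have hsplit : (Xᵀ * X).trace = ((U'ᵀ * X)ᵀ * (U'ᵀ * X)).trace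
      + (((1 - P) * X)ᵀ * ((1 - P) * X)).trace := by
    rw [← Matrix.trace_add]
    congr 1
    have h1 : ((1 - P) * X)ᵀ * ((1 - P) * X) = Xᵀ * ((1 - P) * X) := by
      rw [Matrix.transpose_mul, hPc, Matrix.mul_assoc, ← Matrix.mul_assoc (1 - P), hPPc]
    have h2 : (U'ᵀ * X)ᵀ * (U'ᵀ * X) = Xᵀ * (P * X) := by
      rw [Matrix.transpose_mul, Matrix.transpose_transpose, hP]; simp only [Matrix.mul_assoc]
    rw [h1, h2, ← Matrix.mul_add, ← Matrix.add_mul]; simp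
  have hfirst : ((U'ᵀ * X)ᵀ * (U'ᵀ * X)).trace ≤ n * ε ^ 2 := by
    have h1 : U'ᵀ * X = U'ᵀ * (M' - N) := by
      have : M' - N = X + (M' - N') := by rw [hX]; abel
      rw [this, Matrix.mul_add, hUM, add_zero]
    have hU' := norm_le_one_of_transpose_mul_self h'.orthU
    rw [← norm_transpose] at hU'
    have h2 : ‖(U'ᵀ * X)ᵀ‖ ≤ ε := by
      rw [norm_transpose, h1]
      calc _ ≤ ‖U'ᵀ‖ * ‖M' - N‖ := Matrix.l2_opNorm_mul _ _
        _ ≤ 1 * ε := by gcongr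
        _ = ε := one_mul _
    have h3 := trace_transpose_mul_self_le (U'ᵀ * X)ᵀ
    rw [Matrix.transpose_transpose, Fintype.card_fin, Matrix.trace_mul_comm] at h3
    exact h3.trans (by gcongr)
  have hsecond : (((1 - P) * X)ᵀ * ((1 - P) * X)).trace ≤ n * (2 * ε) ^ 2 := by
    -- Since `1 - P` kills `N'`, only `-(1 - P) * N` remains, and its rows lie in the span of the
    -- `n` columns of `V`.
    have h1 : (1 - P) * X = (1 - P) * X * V * Vᵀ := by
      have hN : N * V * Vᵀ = N := by rw [h.mul_right, ← h.eq]
      have h2 : (1 - P) * X = -((1 - P) * N) := by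
        rw [hX, Matrix.mul_sub, hPN', zero_sub]
      rw [h2, Matrix.neg_mul, Matrix.neg_mul, Matrix.mul_assoc, Matrix.mul_assoc,
        ← Matrix.mul_assoc N, hN]
    have h2 : (((1 - P) * X)ᵀ * ((1 - P) * X)).trace
        = (((1 - P) * X * V)ᵀ * ((1 - P) * X * V)).trace := by
      rw [h1]
      set Z := (1 - P) * X * V
      have : Z * Vᵀ * V = Z := by rw [Matrix.mul_assoc, h.orthV, Matrix.mul_one]
      rw [this, Matrix.transpose_mul, Matrix.transpose_transpose, Matrix.mul_assoc,
        Matrix.trace_mul_comm, Matrix.mul_assoc, Matrix.mul_assoc, h.orthV, Matrix.mul_one]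
    have hVn := norm_le_one_of_transpose_mul_self h.orthV
    have h3 : ‖(1 - P) * X * V‖ ≤ 2 * ε := by
      calc _ ≤ ‖(1 - P) * X‖ * ‖V‖ := Matrix.l2_opNorm_mul _ _
        _ ≤ ‖1 - P‖ * ‖X‖ * ‖V‖ := by gcongr; exact Matrix.l2_opNorm_mul _ _
        _ ≤ 1 * (2 * ε) * 1 := by gcongr
        _ = 2 * ε := by ring
    have h4 := trace_transpose_mul_self_le ((1 - P) * X * V)
    rw [h2]
    rw [Fintype.card_fin] at h4
    exact h4.trans (by gcongr)
  rw [hsplit]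
  linarith

lemma trace_mul_transpose_mul_self_nonneg {K : Matrix κ κ ℝ} (hK : K.PosSemidef)
    (A : Matrix ι κ ℝ) : 0 ≤ (K * (Aᵀ * A)).trace := by
  have h := (hK.mul_mul_conjTranspose_same A).trace_nonneg
  rwa [Matrix.conjTranspose_eq_transpose_of_trivial, Matrix.trace_mul_comm, ← Matrix.mul_assoc,
    Matrix.trace_mul_comm] at h

/-- After substituting `Y`, right side minus left side equals `‖3G + 4K - 4X‖² / 3 + 2 ‖K - X‖² / 3
+ 4 tr (K G)` in Frobenius norms. -/
lemma trace_procrustes_ineq {X Y K G : Matrix κ κ ℝ} (hX : Xᵀ = X) (hK : Kᵀ = K) (hG : Gᵀ = G)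
    (hY : Y = G - X + 2 • K) (hKG : 0 ≤ (K * G).trace) :
    2 * (X * G).trace ≤ 3 * ((Y * Y).trace + (X * X).trace - 2 * (K * K).trace) := by
  have h1 := trace_transpose_mul_self_nonneg ((3 : ℝ) • G + (4 : ℝ) • K - (4 : ℝ) • X)
  have h2 := trace_transpose_mul_self_nonneg (K - X)
  simp only [Matrix.transpose_add, Matrix.transpose_sub, Matrix.transpose_smul, hX, hK, hG] at h1 h2
  have c1 := Matrix.trace_mul_comm K X
  have c2 := Matrix.trace_mul_comm G X
  have c3 := Matrix.trace_mul_comm G K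
  rw [hY, two_smul]
  simp only [Matrix.add_mul, Matrix.mul_add, Matrix.sub_mul, Matrix.mul_sub, Matrix.trace_add,
    Matrix.trace_sub, Matrix.smul_mul, Matrix.mul_smul, Matrix.trace_smul, smul_eq_mul, c1, c2, c3]
    at h1 h2 ⊢
  nlinarith

/-- Two balanced factorizations are close, up to an orthogonal matrix, when the products are. -/
lemma exists_orthogonal_trace_le {O O' : Matrix ι κ ℝ} {R R' : Matrix κ μ ℝ} {s s' : κ → ℝ}
    (hO : Oᵀ * O = Matrix.diagonal s) (hR : R * Rᵀ = Matrix.diagonal s)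
    (hO' : O'ᵀ * O' = Matrix.diagonal s') (hR' : R' * R'ᵀ = Matrix.diagonal s')
    {τ : ℝ} (hs : ∀ i, τ ≤ s i) :
    ∃ Q ∈ Matrix.orthogonalGroup κ ℝ,
      τ * (((O' - O * Q)ᵀ * (O' - O * Q)).trace + ((R' - Qᵀ * R) * (R' - Qᵀ * R)ᵀ).trace)
        ≤ 3 * ((O' * R' - O * R)ᵀ * (O' * R' - O * R)).trace := by
  -- The optimal rotation for the joint Procrustes problem of `O` and `R`: it makes `K = P + T`
  -- symmetric and positive semidefinite.
  obtain ⟨Q, hQ, hpsd⟩ := exists_orthogonal_posSemidef (Oᵀ * O' + R * R'ᵀ)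
  refine ⟨Q, hQ, ?_⟩
  have hQQ : Q * Qᵀ = 1 := (Matrix.mem_orthogonalGroup_iff κ ℝ).1 hQ
  set O₁ := O * Q with hO₁
  set R₁ := Qᵀ * R with hR₁
  set D := Qᵀ * Matrix.diagonal s * Q with hD
  set D' := Matrix.diagonal s' with hD'
  have hOR : O * R = O₁ * R₁ := by
    rw [hO₁, hR₁, Matrix.mul_assoc, ← Matrix.mul_assoc Q, hQQ, Matrix.one_mul]
  have h1 : O₁ᵀ * O₁ = D := by
    rw [hO₁, Matrix.transpose_mul, Matrix.mul_assoc, ← Matrix.mul_assoc Oᵀ, hO, hD,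
      Matrix.mul_assoc]
  have h2 : R₁ * R₁ᵀ = D := by
    rw [hR₁, Matrix.transpose_mul, Matrix.transpose_transpose, Matrix.mul_assoc,
      ← Matrix.mul_assoc R, hR, hD, Matrix.mul_assoc]
  set P := O₁ᵀ * O' with hP
  set T := R₁ * R'ᵀ with hT
  have hPt : Pᵀ = O'ᵀ * O₁ := by rw [hP, Matrix.transpose_mul, Matrix.transpose_transpose]
  have hTt : Tᵀ = R' * R₁ᵀ := by rw [hT, Matrix.transpose_mul, Matrix.transpose_transpose]
  set K := P + T with hKdef
  have hKpsd : K.PosSemidef := by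
    have : K = Qᵀ * (Oᵀ * O' + R * R'ᵀ) := by
      rw [hKdef, hP, hT, hO₁, hR₁, Matrix.transpose_mul, Matrix.mul_add]
      simp only [Matrix.mul_assoc]
    rw [this]; exact hpsd
  have hKt : Kᵀ = K := by simpa using hKpsd.1.eq
  have hDt : Dᵀ = D := by rw [← h1]; simp
  set G := (O' - O₁)ᵀ * (O' - O₁) + (R' - R₁) * (R' - R₁)ᵀ with hG
  have hGt : Gᵀ = G := by rw [hG]; simp
  have hGeq : G = 2 • D' + 2 • D - 2 • K := by
    have h3 : (O' - O₁)ᵀ * (O' - O₁) = D' - P - Pᵀ + D := by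
      rw [Matrix.transpose_sub, Matrix.sub_mul, Matrix.mul_sub, Matrix.mul_sub, hO', h1, hPt]
      abel
    have h4 : (R' - R₁) * (R' - R₁)ᵀ = D' - T - Tᵀ + D := by
      rw [Matrix.transpose_sub, Matrix.sub_mul, Matrix.mul_sub, Matrix.mul_sub, hR', h2, hTt]
      abel
    have h5 : Pᵀ + Tᵀ = P + T := by rw [← Matrix.transpose_add]; exact hKt
    calc G = 2 • D' + 2 • D - (P + T) - (Pᵀ + Tᵀ) := by rw [hG, h3, h4]; abel
      _ = _ := by rw [h5, hKdef]; abel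
  have hnn : ∀ {Z : Matrix κ κ ℝ}, Z.PosSemidef → 0 ≤ (Z * G).trace := by
    intro Z hZ
    have h3 := trace_mul_transpose_mul_self_nonneg hZ (O' - O₁)
    have h4 := trace_mul_transpose_mul_self_nonneg hZ (R' - R₁)ᵀ
    rw [Matrix.transpose_transpose] at h4
    rw [hG, Matrix.mul_add, Matrix.trace_add]; linarith
  -- The factor 2 matches `G = 2 D' + 2 D - 2 K`, which holds because both pairs of factors have
  -- equal Gram matrices `D`, respectively `D'`.
  have hmain := trace_procrustes_ineq (X := 2 • D) (Y := 2 • D') (K := K) (G := G)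
    (by rw [Matrix.transpose_smul, hDt]) hKt hGt (by rw [hGeq]; abel) (hnn hKpsd)
  have hDτ : (D - τ • (1 : Matrix κ κ ℝ)).PosSemidef := by
    have h3 : (Matrix.diagonal s - τ • (1 : Matrix κ κ ℝ)).PosSemidef := by
      rw [Matrix.smul_one_eq_diagonal, Matrix.diagonal_sub]
      exact Matrix.PosSemidef.diagonal fun i => sub_nonneg.2 (hs i)
    have h4 := h3.conjTranspose_mul_mul_same Q
    have hQ' : Qᵀ * Q = 1 := (Matrix.mem_orthogonalGroup_iff' κ ℝ).1 hQ
    rwa [Matrix.conjTranspose_eq_transpose_of_trivial, Matrix.mul_sub, Matrix.sub_mul,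
      Matrix.mul_smul, Matrix.mul_one, Matrix.smul_mul, hQ'] at h4
  have hlow := hnn hDτ
  rw [Matrix.sub_mul, Matrix.trace_sub, Matrix.smul_mul, Matrix.one_mul, Matrix.trace_smul,
    smul_eq_mul] at hlow
  have hGtr : G.trace = ((O' - O₁)ᵀ * (O' - O₁)).trace + ((R' - R₁) * (R' - R₁)ᵀ).trace := by
    rw [hG, Matrix.trace_add]
  rw [hOR, ← hGtr]
  have hPT := trace_transpose_mul_self_nonneg (P - T)
  have hKK : (K * K).trace = (Pᵀ * P).trace + 2 * (Pᵀ * T).trace + (Tᵀ * T).trace := by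
    nth_rewrite 1 [← hKt]
    rw [hKdef, Matrix.transpose_add, Matrix.add_mul, Matrix.mul_add, Matrix.mul_add]
    simp only [Matrix.trace_add]
    have : (Tᵀ * P).trace = (Pᵀ * T).trace := by
      rw [← Matrix.trace_transpose, Matrix.transpose_mul, Matrix.transpose_transpose]
    rw [this]; ring
  -- This gives `tr (K K) ≥ 4 tr (Pᵀ T)`, which turns the right side of `hmain` into twelve times
  -- the squared distance of the products (`hN`), against `4 tr (D G) ≥ 4 τ tr G` on the left.
  have hPT' : 2 * (Pᵀ * T).trace ≤ (Pᵀ * P).trace + (Tᵀ * T).trace := by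
    rw [Matrix.transpose_sub, Matrix.sub_mul, Matrix.mul_sub, Matrix.mul_sub] at hPT
    simp only [Matrix.trace_sub] at hPT
    have : (Tᵀ * P).trace = (Pᵀ * T).trace := by
      rw [← Matrix.trace_transpose, Matrix.transpose_mul, Matrix.transpose_transpose]
    rw [this] at hPT; linarith
  have hN : ((O' * R' - O₁ * R₁)ᵀ * (O' * R' - O₁ * R₁)).trace
      = (D' * D').trace + (D * D).trace - 2 * (Pᵀ * T).trace := by
    have e1 : ∀ (A C : Matrix ι κ ℝ) (B E : Matrix κ μ ℝ),
        ((A * B)ᵀ * (C * E)).trace = ((Aᵀ * C) * (E * Bᵀ)).trace := by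
      intro A C B E
      rw [Matrix.transpose_mul, Matrix.mul_assoc, Matrix.trace_mul_comm]
      simp only [Matrix.mul_assoc]
    have e2 : (Matrix.trace ((O₁ᵀ * O') * (R' * R₁ᵀ))) = (Pᵀ * T).trace := by
      rw [← Matrix.trace_transpose, Matrix.trace_mul_comm Pᵀ, hP, hT, Matrix.transpose_mul,
        Matrix.transpose_mul, Matrix.transpose_transpose]
    have e3 : (Matrix.trace ((O'ᵀ * O₁) * (R₁ * R'ᵀ))) = (Pᵀ * T).trace := by
      rw [hP, hT, Matrix.transpose_mul, Matrix.transpose_transpose]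
    rw [Matrix.transpose_sub, Matrix.sub_mul, Matrix.mul_sub, Matrix.mul_sub]
    simp only [Matrix.trace_sub, e1, e2, e3, hO', hR', h1, h2]
    ring
  rw [hN]
  simp only [two_smul, Matrix.add_mul, Matrix.mul_add, Matrix.trace_add] at hmain
  nlinarith

end Perturbation

/-! ### Perturbation of Moore-Penrose inverses. -/

section MoorePenrose

variable {ι κ μ ν : Type*} [Fintype ι] [Fintype κ] [Fintype μ] [Fintype ν]
  [DecidableEq ι] [DecidableEq κ] [DecidableEq μ] [DecidableEq ν]

lemma IsMoorePenrose.transpose {M : Matrix ι κ ℝ} {P : Matrix κ ι ℝ} (h : IsMoorePenrose M P) :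
    IsMoorePenrose Mᵀ Pᵀ where
  mul_mul := by
    rw [← Matrix.transpose_mul, ← Matrix.transpose_mul, ← Matrix.mul_assoc, h.mul_mul]
  mul_mul' := by
    rw [← Matrix.transpose_mul, ← Matrix.transpose_mul, ← Matrix.mul_assoc, h.mul_mul']
  symm_left := by rw [← Matrix.transpose_mul, h.symm_right, h.symm_right]
  symm_right := by rw [← Matrix.transpose_mul, h.symm_left, h.symm_left]

lemma IsMoorePenrose.mul_orthogonal {M : Matrix ι κ ℝ} {P : Matrix κ ι ℝ} (h : IsMoorePenrose M P)
    {Q : Matrix κ κ ℝ} (hQ : Q ∈ Matrix.orthogonalGroup κ ℝ) :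
    IsMoorePenrose (M * Q) (Qᵀ * P) := by
  have hQQ : Q * Qᵀ = 1 := (Matrix.mem_orthogonalGroup_iff κ ℝ).1 hQ
  have h1 : M * Q * (Qᵀ * P) = M * P := by
    rw [Matrix.mul_assoc, ← Matrix.mul_assoc Q, hQQ, Matrix.one_mul]
  refine ⟨?_, ?_, ?_, ?_⟩
  · rw [h1, ← Matrix.mul_assoc, h.mul_mul]
  · rw [Matrix.mul_assoc, h1, Matrix.mul_assoc, ← Matrix.mul_assoc P, h.mul_mul']
  · rw [h1, h.symm_left]
  · have : Qᵀ * P * (M * Q) = Qᵀ * (P * M) * Q := by simp only [Matrix.mul_assoc]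
    rw [this, Matrix.transpose_mul, Matrix.transpose_mul, Matrix.transpose_transpose, h.symm_right,
      ← Matrix.mul_assoc]

lemma IsMoorePenrose.mul_eq_one {M : Matrix ι κ ℝ} {P : Matrix κ ι ℝ} (h : IsMoorePenrose M P)
    (hM : IsUnit (Mᵀ * M)) : P * M = 1 := by
  refine hM.mul_left_cancel ?_
  rw [Matrix.mul_one, Matrix.mul_assoc, ← Matrix.mul_assoc M, h.mul_mul]

/-- Apply the lower bound to `P y` and use that `M * P` is an orthogonal projection. -/
lemma IsMoorePenrose.norm_sq_le {M : Matrix ι κ ℝ} {P : Matrix κ ι ℝ} (h : IsMoorePenrose M P)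
    {c : ℝ} (hc : 0 < c) (hM : ∀ x, c * (x ⬝ᵥ x) ≤ (M *ᵥ x) ⬝ᵥ (M *ᵥ x)) : ‖P‖ ^ 2 ≤ c⁻¹ := by
  refine norm_sq_le_of_mulVec_sq_le _ (inv_nonneg.2 hc.le) fun y => ?_
  have hn : ‖M * P‖ ≤ 1 := norm_le_one_of_isSymm_of_mul_self h.symm_left
    (by rw [← Matrix.mul_assoc, h.mul_mul])
  have h1 := hM (P *ᵥ y)
  rw [Matrix.mulVec_mulVec] at h1
  have h2 := mulVec_sq_le (M * P) y
  have h3 : ‖M * P‖ ^ 2 * (y ⬝ᵥ y) ≤ y ⬝ᵥ y :=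
    mul_le_of_le_one_left (dotProduct_self_nonneg y) (pow_le_one₀ (norm_nonneg _) hn)
  rw [le_inv_mul_iff₀ hc]
  linarith

/-- Perturbation of the Moore-Penrose inverse of a matrix of full column rank. -/
lemma IsMoorePenrose.norm_sub_le {M M' : Matrix ι κ ℝ} {P P' : Matrix κ ι ℝ}
    (h : IsMoorePenrose M P) (h' : IsMoorePenrose M' P') (h1' : P' * M' = 1) :
    ‖P' - P‖ ≤ ‖M' - M‖ * (‖P'‖ * ‖P‖ + ‖P'‖ ^ 2) := by
  have hs : (1 - M * P)ᵀ = 1 - M * P := by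
    rw [Matrix.transpose_sub, h.symm_left, Matrix.transpose_one]
  have hn : ‖1 - M * P‖ ≤ 1 := norm_le_one_of_isSymm_of_mul_self hs (by
    have : M * P * (M * P) = M * P := by rw [← Matrix.mul_assoc, h.mul_mul]
    rw [Matrix.sub_mul, Matrix.mul_sub, Matrix.mul_sub, this]; simp)
  have h0 : Mᵀ * (1 - M * P) = 0 := by
    rw [← hs, ← Matrix.transpose_mul, Matrix.sub_mul, h.mul_mul, Matrix.one_mul, sub_self,
      Matrix.transpose_zero]
  have h2 : P' * (1 - M * P) = P' * P'ᵀ * (M' - M)ᵀ * (1 - M * P) := by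
    have h3 : P' = P' * P'ᵀ * M'ᵀ := by
      rw [Matrix.mul_assoc, ← Matrix.transpose_mul, h'.symm_left, ← Matrix.mul_assoc, h'.mul_mul']
    rw [Matrix.transpose_sub, Matrix.mul_sub _ M'ᵀ, Matrix.sub_mul, Matrix.mul_assoc _ Mᵀ, h0,
      Matrix.mul_zero, sub_zero, ← h3]
  -- Wedin's decomposition; its third term vanishes because `P' * M' = 1`.
  have h4 : P' - P = P' * P'ᵀ * (M' - M)ᵀ * (1 - M * P) - P' * (M' - M) * P := by
    rw [← h2, Matrix.mul_sub, Matrix.mul_sub, h1', Matrix.sub_mul, Matrix.one_mul, Matrix.mul_one,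
      Matrix.mul_assoc P' M P]
    abel
  rw [h4]
  have h5 : ‖P' * P'ᵀ * (M' - M)ᵀ * (1 - M * P)‖ ≤ ‖P'‖ * ‖P'‖ * ‖M' - M‖ * 1 := by
    calc _ ≤ ‖P' * P'ᵀ * (M' - M)ᵀ‖ * ‖1 - M * P‖ := Matrix.l2_opNorm_mul _ _
      _ ≤ ‖P' * P'ᵀ‖ * ‖(M' - M)ᵀ‖ * ‖1 - M * P‖ := by gcongr; exact Matrix.l2_opNorm_mul _ _
      _ ≤ ‖P'‖ * ‖P'ᵀ‖ * ‖(M' - M)ᵀ‖ * 1 := by gcongr; exact Matrix.l2_opNorm_mul _ _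
      _ = _ := by rw [norm_transpose, norm_transpose]
  have h6 : ‖P' * (M' - M) * P‖ ≤ ‖P'‖ * ‖M' - M‖ * ‖P‖ :=
    (Matrix.l2_opNorm_mul _ _).trans (by gcongr; exact Matrix.l2_opNorm_mul _ _)
  refine (_root_.norm_sub_le _ _).trans ((add_le_add h5 h6).trans (le_of_eq ?_))
  ring

lemma norm_mul_mul_sub_le (P P' : Matrix κ ι ℝ) (H H' : Matrix ι μ ℝ) (W W' : Matrix μ ν ℝ) :
    ‖P' * H' * W' - P * H * W‖
      ≤ ‖P' - P‖ * ‖H‖ * ‖W‖ + ‖P'‖ * ‖H' - H‖ * ‖W‖ + ‖P'‖ * ‖H'‖ * ‖W' - W‖ := by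
  have h : P' * H' * W' - P * H * W
      = (P' - P) * H * W + P' * (H' - H) * W + P' * H' * (W' - W) := by
    simp only [Matrix.sub_mul, Matrix.mul_sub]; abel
  have hm : ∀ (X : Matrix κ ι ℝ) (Y : Matrix ι μ ℝ) (Z : Matrix μ ν ℝ),
      ‖X * Y * Z‖ ≤ ‖X‖ * ‖Y‖ * ‖Z‖ := fun X Y Z =>
    (Matrix.l2_opNorm_mul _ _).trans (by gcongr; exact Matrix.l2_opNorm_mul _ _)
  rw [h]
  exact (norm_add₃_le).trans (add_le_add_three (hm _ _ _) (hm _ _ _) (hm _ _ _))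

end MoorePenrose

/-! ### Ranks of products and singular values of matrices with a common left factor. -/

section Rank

variable {ι κ μ : Type*} [Fintype ι] [Fintype κ] [Fintype μ]
  [DecidableEq ι] [DecidableEq κ] [DecidableEq μ]

lemma rank_mul_eq_of_mulVec_injective {A : Matrix ι κ ℝ} (hA : ∀ x, A *ᵥ x = 0 → x = 0)
    (B : Matrix κ μ ℝ) : (A * B).rank = B.rank := by
  have hinj : Function.Injective A.mulVecLin := LinearMap.ker_eq_bot.1 (LinearMap.ker_eq_bot'.2 hA)
  rw [Matrix.rank, Matrix.rank, Matrix.mulVecLin_mul, LinearMap.range_comp]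
  exact (Submodule.equivMapOfInjective _ hinj _).finrank_eq.symm

lemma rank_mul_eq_card {A : Matrix ι κ ℝ} {B : Matrix κ μ ℝ} (hA : ∀ x, A *ᵥ x = 0 → x = 0)
    (hB : ∀ y, Bᵀ *ᵥ y = 0 → y = 0) : (A * B).rank = Fintype.card κ := by
  rw [rank_mul_eq_of_mulVec_injective hA, ← Matrix.rank_transpose,
    rank_eq_card_of_mulVec_injective hB]

lemma exists_mulVec_eq {B : Matrix κ μ ℝ} (hB : ∀ y, Bᵀ *ᵥ y = 0 → y = 0) (y : κ → ℝ) :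
    ∃ x, B *ᵥ x = y := by
  have h : B.rank = Fintype.card κ := by
    rw [← Matrix.rank_transpose, rank_eq_card_of_mulVec_injective hB]
  have : B.mulVecLin.range = ⊤ := Submodule.eq_top_of_finrank_eq (by
    rw [← Matrix.rank, h, Module.finrank_fintype_fun_eq_card])
  exact LinearMap.range_eq_top.1 this y

lemma IsSVD.pos_of_rank_eq {n : ℕ} {M : Matrix ι κ ℝ} {U : Matrix ι (Fin n) ℝ} {s : Fin n → ℝ}
    {V : Matrix κ (Fin n) ℝ} (h : IsSVD M U s V) (hM : M.rank = n) (i : Fin n) : 0 < s i := by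
  refine (h.nonneg i).lt_of_ne' fun hi => ?_
  have h1 : n ≤ (Matrix.diagonal s).rank := by
    refine hM.ge.trans ?_
    rw [h.eq]
    exact (Matrix.rank_mul_le_left _ _).trans (Matrix.rank_mul_le_right _ _)
  rw [Matrix.rank_diagonal] at h1
  have h2 : Fintype.card {i // s i ≠ 0} < Fintype.card (Fin n) :=
    Fintype.card_subtype_lt (p := fun i => s i ≠ 0) (x := i) (by simpa using hi)
  rw [Fintype.card_fin] at h2
  omega

/-- Comparison of the `n`-th singular values of two matrices of rank `n` with a common left
factor. -/
lemma IsSVD.sigma_sq_le {ν : Type*} [Fintype ν] [DecidableEq ν] {n : ℕ} {O : Matrix ι (Fin n) ℝ}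
    {K : Matrix (Fin n) κ ℝ} {K' : Matrix (Fin n) ν ℝ}
    {U : Matrix ι (Fin n) ℝ} {s : Fin n → ℝ} {V : Matrix κ (Fin n) ℝ} (h : IsSVD (O * K) U s V)
    (hO : ∀ x, O *ᵥ x = 0 → x = 0) (hK : ∀ y, Kᵀ *ᵥ y = 0 → y = 0)
    (hK' : ∀ y, K'ᵀ *ᵥ y = 0 → y = 0) {η : ℝ}
    (hη : ∀ y, (K'ᵀ *ᵥ y) ⬝ᵥ (K'ᵀ *ᵥ y) ≤ (1 + η) * ((Kᵀ *ᵥ y) ⬝ᵥ (Kᵀ *ᵥ y))) (i : Fin n) :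
    sigma n (O * K') ^ 2 ≤ (1 + η) * s i ^ 2 := by
  have hr : (O * K).rank = n := by rw [rank_mul_eq_card hO hK, Fintype.card_fin]
  have hr' : (O * K').rank = n := by rw [rank_mul_eq_card hO hK', Fintype.card_fin]
  have hpos := h.pos_of_rank_eq hr i
  set e : Fin n → ℝ := Pi.single i 1
  set u := U *ᵥ e
  have hDe : ∀ c : ℝ, Matrix.diagonal s *ᵥ (c • e) = (c * s i) • e := fun c => by
    ext j
    rw [Matrix.mulVec_diagonal]
    by_cases hj : j = i
    · subst hj; simp [e, mul_comm]
    · simp [e, hj]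
  have hu : u = (O * K) *ᵥ (V *ᵥ ((s i)⁻¹ • e)) := by
    rw [Matrix.mulVec_mulVec, h.mul_right, ← Matrix.mulVec_mulVec, hDe, inv_mul_cancel₀ hpos.ne',
      one_smul]
  -- The left singular vector `u` of `O * K` also lies in the range of `O * K'`, since `K'` is onto.
  -- There `(O * K')ᵀ` expands by at least `sigma n (O * K')`, whereas `(O * K)ᵀ` maps `u` to a
  -- vector of length `s i`.
  obtain ⟨x, hx⟩ := exists_mulVec_eq hK' (K *ᵥ (V *ᵥ ((s i)⁻¹ • e)))
  have hux : u = (O * K') *ᵥ x := by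
    rw [hu, ← Matrix.mulVec_mulVec, ← Matrix.mulVec_mulVec, hx]
  have hee : e ⬝ᵥ e = 1 := by simp [e]
  have huu : u ⬝ᵥ u = 1 := by rw [mulVec_sq_eq_of_transpose_mul_self h.orthU, hee]
  have h1 := sigma_sq_mul_le hr' x
  rw [← hux, huu, mul_one, Matrix.transpose_mul, ← Matrix.mulVec_mulVec] at h1
  refine h1.trans ((hη _).trans (le_of_eq ?_))
  have h2 : Kᵀ *ᵥ (Oᵀ *ᵥ u) = V *ᵥ (s i • e) := by
    rw [Matrix.mulVec_mulVec, ← Matrix.transpose_mul, h.eq, Matrix.transpose_mul,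
      Matrix.transpose_mul, Matrix.transpose_transpose, Matrix.diagonal_transpose]
    have h3 := hDe 1
    rw [one_smul, one_mul] at h3
    rw [← h3, Matrix.mulVec_mulVec, Matrix.mulVec_mulVec, Matrix.mul_assoc, Matrix.mul_assoc,
      h.orthU, Matrix.mul_one]
  rw [h2, mulVec_sq_eq_of_transpose_mul_self h.orthV, smul_dotProduct, dotProduct_smul, hee]
  simp [sq]

end Rank

/-! ### Norms of block Hankel matrices. -/

section Hankel

variable {m p d₁ d₂ He : ℕ}

lemma hankel_sub (h : d₁ + d₂ + 1 = He) (G G' : Matrix (Fin m) (Cols He m p) ℝ) :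
    hankel h G' - hankel h G = hankel h (G' - G) := by
  ext r c
  rcases c with ⟨k, b⟩ | ⟨k, b⟩ <;> rfl

lemma hankelMinus_sub (H H' : Matrix (Fin d₁ × Fin m) (Cols (d₂ + 1) m p) ℝ) :
    hankelMinus H' - hankelMinus H = hankelMinus (H' - H) := rfl

lemma hankelPlus_sub (H H' : Matrix (Fin d₁ × Fin m) (Cols (d₂ + 1) m p) ℝ) :
    hankelPlus H' - hankelPlus H = hankelPlus (H' - H) := rfl

lemma norm_hankelMinus_le (H : Matrix (Fin d₁ × Fin m) (Cols (d₂ + 1) m p) ℝ) :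
    ‖hankelMinus H‖ ≤ ‖H‖ :=
  norm_submatrix_cols_le H (Function.Injective.sumMap
    (Function.Injective.prodMap (Fin.castSucc_injective _) Function.injective_id)
    (Function.Injective.prodMap (Fin.castSucc_injective _) Function.injective_id))

lemma norm_hankelPlus_le (H : Matrix (Fin d₁ × Fin m) (Cols (d₂ + 1) m p) ℝ) :
    ‖hankelPlus H‖ ≤ ‖H‖ :=
  norm_submatrix_cols_le H (Function.Injective.sumMap
    (Function.Injective.prodMap (Fin.succ_injective _) Function.injective_id)
    (Function.Injective.prodMap (Fin.succ_injective _) Function.injective_id))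

/-- Shift of the block index of a column. -/
def shiftCols {k l : ℕ} (j : ℕ) (hj : j + k ≤ l) : Cols k m p → Cols l m p :=
  Sum.map (Prod.map (fun i : Fin k => ⟨j + i, by omega⟩) id)
    (Prod.map (fun i : Fin k => ⟨j + i, by omega⟩) id)

lemma shiftCols_injective {k l : ℕ} (j : ℕ) (hj : j + k ≤ l) :
    Function.Injective (shiftCols (m := m) (p := p) j hj) := by
  have : Function.Injective (fun i : Fin k => (⟨j + i, by omega⟩ : Fin l)) := fun a b hab => by
    have := congrArg Fin.val hab
    simp only at this
    exact Fin.ext (by omega)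
  exact Function.Injective.sumMap (this.prodMap Function.injective_id)
    (this.prodMap Function.injective_id)

/-- Each of the `d₁` block rows is a window of consecutive blocks of `G`, of norm at most `‖G‖`. -/
lemma norm_hankel_sq_le (h : d₁ + d₂ + 1 = He) (G : Matrix (Fin m) (Cols He m p) ℝ) :
    ‖hankel h G‖ ^ 2 ≤ d₁ * ‖G‖ ^ 2 := by
  refine norm_sq_le_of_mulVec_sq_le _ (by positivity) fun x => ?_
  have hj : ∀ j : Fin d₁, (j : ℕ) + (d₂ + 1) ≤ He := fun j => by omega
  have h1 : (hankel h G *ᵥ x) ⬝ᵥ (hankel h G *ᵥ x)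
      = ∑ j : Fin d₁, (G.submatrix id (shiftCols j (hj j)) *ᵥ x) ⬝ᵥ
        (G.submatrix id (shiftCols j (hj j)) *ᵥ x) := by
    rw [dotProduct, Fintype.sum_prod_type]
    refine Finset.sum_congr rfl fun j _ => Finset.sum_congr rfl fun a _ => ?_
    have : (hankel h G *ᵥ x) (j, a) = (G.submatrix id (shiftCols j (hj j)) *ᵥ x) a := by
      refine Finset.sum_congr rfl fun c _ => ?_
      rcases c with ⟨k, b⟩ | ⟨k, b⟩ <;> rfl
    rw [this]
  rw [h1]
  calc _ ≤ ∑ _j : Fin d₁, ‖G‖ ^ 2 * (x ⬝ᵥ x) := by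
        refine Finset.sum_le_sum fun j _ => (mulVec_sq_le _ x).trans ?_
        have := norm_submatrix_cols_le G (shiftCols_injective (m := m) (p := p) j (hj j))
        have := dotProduct_self_nonneg x
        gcongr
    _ = d₁ * ‖G‖ ^ 2 * (x ⬝ᵥ x) := by simp [mul_assoc]

/-- Counting by block columns gives a bound independent of `d₁`, needed when `d₂` is small compared
with `He`: for fixed `k`, the entries in output row `a` form a window of row `a` of `G`, and the
squared Frobenius norm of `G` is at most `m ‖G‖²`. -/
lemma norm_hankelMinus_hankel_sq_le (h : d₁ + d₂ + 1 = He) (G : Matrix (Fin m) (Cols He m p) ℝ) :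
    ‖hankelMinus (hankel h G)‖ ^ 2 ≤ m * d₂ * ‖G‖ ^ 2 := by
  refine (norm_sq_le_trace _).trans ?_
  have hk : ∀ k : Fin d₂, (k : ℕ) + d₁ ≤ He := fun k => by omega
  have h1 : ((hankelMinus (hankel h G))ᵀ * hankelMinus (hankel h G)).trace
      = ∑ k : Fin d₂, ∑ a : Fin m, (G a ∘ shiftCols k (hk k)) ⬝ᵥ (G a ∘ shiftCols k (hk k)) := by
    have h2 : ∀ (j : Fin d₁) (a : Fin m), ∑ c, hankelMinus (hankel h G) (j, a) c ^ 2
        = ∑ k : Fin d₂, (∑ b : Fin m, G a (shiftCols k (hk k) (Sum.inl (j, b))) ^ 2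
          + ∑ b : Fin p, G a (shiftCols k (hk k) (Sum.inr (j, b))) ^ 2) := by
      intro j a
      rw [Fintype.sum_sum_type, Fintype.sum_prod_type, Fintype.sum_prod_type,
        ← Finset.sum_add_distrib]
      refine Finset.sum_congr rfl fun k _ => ?_
      have e : ∀ hlt, (⟨(j : ℕ) + (k : ℕ), hlt⟩ : Fin He) = ⟨(k : ℕ) + (j : ℕ), by omega⟩ :=
        fun _ => Fin.ext (add_comm _ _)
      congr 1
      · refine Finset.sum_congr rfl fun b _ => ?_
        change G a (Sum.inl (⟨(j : ℕ) + (k : ℕ), _⟩, b)) ^ 2 = _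
        rw [e]; rfl
      · refine Finset.sum_congr rfl fun b _ => ?_
        change G a (Sum.inr (⟨(j : ℕ) + (k : ℕ), _⟩, b)) ^ 2 = _
        rw [e]; rfl
    rw [trace_transpose_mul_self, Fintype.sum_prod_type]
    simp only [h2]
    calc _ = ∑ a : Fin m, ∑ j : Fin d₁, ∑ k : Fin d₂, (_ + _) := Finset.sum_comm
      _ = ∑ a : Fin m, ∑ k : Fin d₂, ∑ j : Fin d₁, (_ + _) :=
          Finset.sum_congr rfl fun a _ => Finset.sum_comm
      _ = ∑ k : Fin d₂, ∑ a : Fin m, ∑ j : Fin d₁, (_ + _) := Finset.sum_comm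
      _ = _ := by
        refine Finset.sum_congr rfl fun k _ => Finset.sum_congr rfl fun a _ => ?_
        rw [dotProduct, Fintype.sum_sum_type, Fintype.sum_prod_type, Fintype.sum_prod_type,
          ← Finset.sum_add_distrib]
        simp [sq]
  rw [h1]
  have h3 : ∑ a : Fin m, G a ⬝ᵥ G a ≤ m * ‖G‖ ^ 2 := by
    have := trace_transpose_mul_self_le Gᵀ
    rw [Fintype.card_fin, norm_transpose, Matrix.transpose_transpose] at this
    exact this
  calc _ ≤ ∑ _k : Fin d₂, ∑ a : Fin m, G a ⬝ᵥ G a :=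
        Finset.sum_le_sum fun k _ => Finset.sum_le_sum fun a _ =>
          dotProduct_comp_le _ (shiftCols_injective _ _)
    _ = d₂ * ∑ a : Fin m, G a ⬝ᵥ G a := by simp
    _ ≤ d₂ * (m * ‖G‖ ^ 2) := by gcongr
    _ = m * d₂ * ‖G‖ ^ 2 := by ring

end Hankel

/-! ### Observability, reachability and decay for the closed loop matrix. -/

section System

variable {n m p q d₁ d₂ He : ℕ}

/-- Controllability matrix `[F, AF, …, A^(d-1)F, B, AB, …, A^(d-1)B]` with two inputs. -/
def reachMatrix (A : Matrix (Fin n) (Fin n) ℝ) (B : Matrix (Fin n) (Fin p) ℝ)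
    (F : Matrix (Fin n) (Fin m) ℝ) (d : ℕ) : Matrix (Fin n) (Cols d m p) ℝ :=
  Matrix.of fun i c => match c with
    | Sum.inl (k, b) => (A ^ (k : ℕ) * F) i b
    | Sum.inr (k, b) => (A ^ (k : ℕ) * B) i b

lemma hankel_arxMatrix (h : d₁ + d₂ + 1 = He) (A : Matrix (Fin n) (Fin n) ℝ)
    (B : Matrix (Fin n) (Fin p) ℝ) (C : Matrix (Fin m) (Fin n) ℝ) (F : Matrix (Fin n) (Fin m) ℝ) :
    hankel h (arxMatrix A B C F He)
      = obsvMatrix (A - F * C) C d₁ * reachMatrix (A - F * C) B F (d₂ + 1) := by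
  ext ⟨j, a⟩ c
  rcases c with ⟨k, b⟩ | ⟨k, b⟩
  · have : C * (A - F * C) ^ ((j : ℕ) + (k : ℕ)) * F
        = (C * (A - F * C) ^ (j : ℕ)) * ((A - F * C) ^ (k : ℕ) * F) := by
      rw [pow_add]; simp only [Matrix.mul_assoc]
    exact congrFun (congrFun this a) b
  · have : C * (A - F * C) ^ ((j : ℕ) + (k : ℕ)) * B
        = (C * (A - F * C) ^ (j : ℕ)) * ((A - F * C) ^ (k : ℕ) * B) := by
      rw [pow_add]; simp only [Matrix.mul_assoc]
    exact congrFun (congrFun this a) b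

lemma hankelMinus_mul_reachMatrix (O : Matrix (Fin d₁ × Fin m) (Fin n) ℝ)
    (A : Matrix (Fin n) (Fin n) ℝ) (B : Matrix (Fin n) (Fin p) ℝ) (F : Matrix (Fin n) (Fin m) ℝ) :
    hankelMinus (O * reachMatrix A B F (d₂ + 1)) = O * reachMatrix A B F d₂ := by
  ext r c
  rcases c with ⟨k, b⟩ | ⟨k, b⟩ <;> rfl

lemma obsvMatrix_mulVec_sq (A : Matrix (Fin n) (Fin n) ℝ) (C : Matrix (Fin q) (Fin n) ℝ) (k : ℕ)
    (x : Fin n → ℝ) : (obsvMatrix A C k *ᵥ x) ⬝ᵥ (obsvMatrix A C k *ᵥ x)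
      = ∑ j ∈ Finset.range k, ((C * A ^ j) *ᵥ x) ⬝ᵥ ((C * A ^ j) *ᵥ x) := by
  rw [dotProduct, Fintype.sum_prod_type, Finset.sum_range]
  rfl

lemma ctrbMatrix_transpose_mulVec_sq (A : Matrix (Fin n) (Fin n) ℝ) (B : Matrix (Fin n) (Fin q) ℝ)
    (k : ℕ) (y : Fin n → ℝ) : ((ctrbMatrix A B k)ᵀ *ᵥ y) ⬝ᵥ ((ctrbMatrix A B k)ᵀ *ᵥ y)
      = ∑ j ∈ Finset.range k, ((A ^ j * B)ᵀ *ᵥ y) ⬝ᵥ ((A ^ j * B)ᵀ *ᵥ y) := by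
  rw [dotProduct, Fintype.sum_prod_type, Finset.sum_range]
  rfl

lemma reachMatrix_transpose_mulVec_sq (A : Matrix (Fin n) (Fin n) ℝ) (B : Matrix (Fin n) (Fin p) ℝ)
    (F : Matrix (Fin n) (Fin m) ℝ) (d : ℕ) (y : Fin n → ℝ) :
    ((reachMatrix A B F d)ᵀ *ᵥ y) ⬝ᵥ ((reachMatrix A B F d)ᵀ *ᵥ y)
      = ∑ j ∈ Finset.range d, (((A ^ j * F)ᵀ *ᵥ y) ⬝ᵥ ((A ^ j * F)ᵀ *ᵥ y)
        + ((A ^ j * B)ᵀ *ᵥ y) ⬝ᵥ ((A ^ j * B)ᵀ *ᵥ y)) := by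
  rw [dotProduct, Fintype.sum_sum_type, Fintype.sum_prod_type, Fintype.sum_prod_type,
    Finset.sum_add_distrib, Finset.sum_range, Finset.sum_range]
  rfl

/-- Output injection does not change the trajectory of a state that produces no output. -/
lemma sub_mul_pow_mulVec_eq (A : Matrix (Fin n) (Fin n) ℝ) (F : Matrix (Fin n) (Fin q) ℝ)
    (C : Matrix (Fin q) (Fin n) ℝ) (x : Fin n → ℝ) (d : ℕ)
    (h : ∀ k < d, (C * (A - F * C) ^ k) *ᵥ x = 0) :
    ∀ k ≤ d, (A - F * C) ^ k *ᵥ x = A ^ k *ᵥ x := by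
  intro k
  induction k with
  | zero => intro _; rfl
  | succ k ih =>
    intro hk
    have h1 := h k (by omega)
    rw [pow_succ', pow_succ', ← Matrix.mulVec_mulVec, Matrix.sub_mulVec, ← Matrix.mulVec_mulVec,
      Matrix.mulVec_mulVec _ C, h1, Matrix.mulVec_zero, sub_zero, ih (by omega),
      Matrix.mulVec_mulVec]

lemma IsObservable.eq_zero {A : Matrix (Fin n) (Fin n) ℝ} {C : Matrix (Fin q) (Fin n) ℝ}
    (h : IsObservable A C) (x : Fin n → ℝ) (hx : ∀ k < n, (C * A ^ k) *ᵥ x = 0) : x = 0 := by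
  refine mulVec_eq_zero_of_rank_eq_card (h.trans (Fintype.card_fin n).symm) x ?_
  rw [← dotProduct_self_eq_zero, obsvMatrix_mulVec_sq]
  exact Finset.sum_eq_zero fun k hk => by rw [hx k (Finset.mem_range.1 hk)]; simp

lemma IsControllable.eq_zero {A : Matrix (Fin n) (Fin n) ℝ} {B : Matrix (Fin n) (Fin q) ℝ}
    (h : IsControllable A B) (y : Fin n → ℝ) (hy : ∀ k < n, (A ^ k * B)ᵀ *ᵥ y = 0) : y = 0 := by
  have hr : (ctrbMatrix A B n)ᵀ.rank = Fintype.card (Fin n) := by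
    rw [Matrix.rank_transpose, Fintype.card_fin]; exact h
  refine mulVec_eq_zero_of_rank_eq_card hr y ?_
  rw [← dotProduct_self_eq_zero, ctrbMatrix_transpose_mulVec_sq]
  exact Finset.sum_eq_zero fun k hk => by rw [hy k (Finset.mem_range.1 hk)]; simp

/-- A state invisible to the pair `(A - F * C, C)` follows the same trajectory under `A`, so it is
invisible to `(A, C)` as well. -/
lemma obsvMatrix_sub_mul_injective {A : Matrix (Fin n) (Fin n) ℝ} {C : Matrix (Fin q) (Fin n) ℝ}
    (h : IsObservable A C) (F : Matrix (Fin n) (Fin q) ℝ) {d : ℕ} (hd : n ≤ d) (x : Fin n → ℝ)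
    (hx : obsvMatrix (A - F * C) C d *ᵥ x = 0) : x = 0 := by
  have h1 : ∀ k < n, (C * (A - F * C) ^ k) *ᵥ x = 0 := fun k hk => by
    rw [← dotProduct_self_eq_zero, obsvMatrix_mulVec_sq] at hx
    exact dotProduct_self_eq_zero.1
      ((Finset.sum_eq_zero_iff_of_nonneg fun j _ => dotProduct_self_nonneg _).1 hx k
        (Finset.mem_range.2 (by omega)))
  refine h.eq_zero x fun k hk => ?_
  rw [← Matrix.mulVec_mulVec, ← sub_mul_pow_mulVec_eq A F C x n h1 k hk.le, Matrix.mulVec_mulVec]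
  exact h1 k hk

/-- Dual to the observability statement, with `(Aᵀ, Cᵀ, Fᵀ)` in the roles of `(A, F, C)`; the blocks
of `F` alone already span. -/
lemma reachMatrix_sub_mul_injective {A : Matrix (Fin n) (Fin n) ℝ} {F : Matrix (Fin n) (Fin m) ℝ}
    (h : IsControllable A F) (C : Matrix (Fin m) (Fin n) ℝ) (B : Matrix (Fin n) (Fin p) ℝ) {d : ℕ}
    (hd : n ≤ d) (y : Fin n → ℝ) (hy : (reachMatrix (A - F * C) B F d)ᵀ *ᵥ y = 0) : y = 0 := by
  have ht : ∀ k, ((A - F * C) ^ k * F)ᵀ = Fᵀ * (Aᵀ - Cᵀ * Fᵀ) ^ k := fun k => by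
    rw [Matrix.transpose_mul, Matrix.transpose_pow, Matrix.transpose_sub, Matrix.transpose_mul]
  have h1 : ∀ k < n, (Fᵀ * (Aᵀ - Cᵀ * Fᵀ) ^ k) *ᵥ y = 0 := fun k hk => by
    rw [← dotProduct_self_eq_zero, reachMatrix_transpose_mulVec_sq] at hy
    have h2 := (Finset.sum_eq_zero_iff_of_nonneg fun j _ =>
      add_nonneg (dotProduct_self_nonneg _) (dotProduct_self_nonneg _)).1 hy k
        (Finset.mem_range.2 (by omega))
    have h3 := dotProduct_self_nonneg (((A - F * C) ^ k * F)ᵀ *ᵥ y)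
    have h4 := dotProduct_self_nonneg (((A - F * C) ^ k * B)ᵀ *ᵥ y)
    rw [← ht]
    exact dotProduct_self_eq_zero.1 (by linarith)
  refine h.eq_zero y fun k hk => ?_
  rw [Matrix.transpose_mul, Matrix.transpose_pow, ← Matrix.mulVec_mulVec,
    ← sub_mul_pow_mulVec_eq Aᵀ Cᵀ Fᵀ y n h1 k hk.le, Matrix.mulVec_mulVec]
  exact h1 k hk

/-- The closed loop form of the Riccati equation. -/
lemma IsAdmissible.lyapunov {A : Matrix (Fin n) (Fin n) ℝ} {B : Matrix (Fin n) (Fin p) ℝ}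
    {C : Matrix (Fin m) (Fin n) ℝ} {σw σz : ℝ} {S : Matrix (Fin n) (Fin n) ℝ}
    (h : IsAdmissible A B C σw σz S) :
    S = (A - kalmanGain A C S σz * C) * S * (A - kalmanGain A C S σz * C)ᵀ
      + σz ^ 2 • (kalmanGain A C S σz * (kalmanGain A C S σz)ᵀ)
      + σw ^ 2 • (1 : Matrix (Fin n) (Fin n) ℝ) := by
  have hS : Sᵀ = S := by simpa using h.posSemidef.1.eq
  set W := C * S * Cᵀ + σz ^ 2 • (1 : Matrix (Fin m) (Fin m) ℝ) with hW
  have hWpos : W.PosDef := by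
    have h1 : (C * S * Cᵀ).PosSemidef := by
      simpa using h.posSemidef.mul_mul_conjTranspose_same C
    have h2 : (σz ^ 2 • (1 : Matrix (Fin m) (Fin m) ℝ)).PosDef :=
      Matrix.PosDef.one.smul (by have := h.σz_pos; positivity)
    exact Matrix.PosDef.posSemidef_add h1 h2
  have hWt : Wᵀ = W := by simpa using hWpos.1.eq
  have hdet : IsUnit W.det := (Matrix.isUnit_iff_isUnit_det W).1 hWpos.isUnit
  set F := kalmanGain A C S σz with hF
  have hFW : F * W = A * S * Cᵀ := by
    rw [hF, kalmanGain, ← hW, Matrix.mul_assoc, Matrix.nonsing_inv_mul _ hdet, Matrix.mul_one]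
  have hFt : W * Fᵀ = C * S * Aᵀ := by
    have := congrArg Matrix.transpose hFW
    rw [Matrix.transpose_mul, hWt, Matrix.transpose_mul, Matrix.transpose_mul,
      Matrix.transpose_transpose, hS] at this
    rw [this, Matrix.mul_assoc]
  -- Since `F * W = A * S * Cᵀ`, the terms quadratic in `F` cancel one of the two cross terms of `(A
  -- - F * C) * S * (A - F * C)ᵀ`.
  have h1 : F * (C * S * Cᵀ) * Fᵀ + σz ^ 2 • (F * Fᵀ) = A * S * Cᵀ * Fᵀ := by
    rw [← hFW, hW]
    simp only [Matrix.mul_add, Matrix.add_mul, Matrix.mul_smul, Matrix.smul_mul, Matrix.mul_one]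
  have h2 : A * S * Cᵀ * W⁻¹ * C * S * Aᵀ = F * (C * S * Aᵀ) := by
    rw [hF, kalmanGain, ← hW]; simp only [Matrix.mul_assoc]
  have h3 := h.dare
  rw [← hW, h2] at h3
  have h4 : (A - F * C) * S * (A - F * C)ᵀ
      = A * S * Aᵀ - F * (C * S * Aᵀ) - A * S * Cᵀ * Fᵀ + F * (C * S * Cᵀ) * Fᵀ := by
    rw [Matrix.transpose_sub, Matrix.transpose_mul]
    simp only [Matrix.sub_mul, Matrix.mul_sub, Matrix.mul_assoc]
    abel
  rw [h4, add_assoc _ (F * (C * S * Cᵀ) * Fᵀ), h1]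
  nth_rewrite 1 [h3]
  abel

/-- The traces of `A ^ k * S * (A ^ k)ᵀ` are nonnegative and, by the Lyapunov equation, drop at step
`k` by at least `c` times the squared Frobenius norm of `A ^ k`; the sum telescopes. -/
lemma sum_norm_pow_sq_le {A S X : Matrix (Fin n) (Fin n) ℝ} {c : ℝ} (hS : S.PosSemidef)
    (hX : X.PosSemidef) (h : S = A * S * Aᵀ + X + c • (1 : Matrix (Fin n) (Fin n) ℝ))
    (hc : 0 ≤ c) (K : ℕ) : c * ∑ k ∈ Finset.range K, ‖A ^ k‖ ^ 2 ≤ S.trace := by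
  have hstep : ∀ k, c * ‖A ^ k‖ ^ 2
      ≤ (A ^ k * S * (A ^ k)ᵀ).trace - (A ^ (k + 1) * S * (A ^ (k + 1))ᵀ).trace := by
    intro k
    have h1 : A ^ k * S * (A ^ k)ᵀ = A ^ (k + 1) * S * (A ^ (k + 1))ᵀ
        + A ^ k * X * (A ^ k)ᵀ + c • (A ^ k * (A ^ k)ᵀ) := by
      nth_rewrite 1 [h]
      rw [pow_succ, Matrix.transpose_mul]
      simp only [Matrix.mul_add, Matrix.add_mul, Matrix.mul_smul, Matrix.smul_mul, Matrix.mul_one,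
        Matrix.mul_assoc]
    have h2 : 0 ≤ (A ^ k * X * (A ^ k)ᵀ).trace := by
      have := (hX.mul_mul_conjTranspose_same (A ^ k)).trace_nonneg
      rwa [Matrix.conjTranspose_eq_transpose_of_trivial] at this
    have h3 := norm_sq_le_trace (A ^ k)
    rw [Matrix.trace_mul_comm] at h3
    rw [h1, Matrix.trace_add, Matrix.trace_add, Matrix.trace_smul, smul_eq_mul]
    have := mul_le_mul_of_nonneg_left h3 hc
    linarith
  have h0 : 0 ≤ (A ^ K * S * (A ^ K)ᵀ).trace := by
    have := (hS.mul_mul_conjTranspose_same (A ^ K)).trace_nonneg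
    rwa [Matrix.conjTranspose_eq_transpose_of_trivial] at this
  rw [Finset.mul_sum]
  refine (Finset.sum_le_sum fun k _ => hstep k).trans ?_
  rw [Finset.sum_range_sub' (fun k => (A ^ k * S * (A ^ k)ᵀ).trace)]
  simpa using h0

/-- The closed loop matrix of an admissible system has square summable powers. -/
lemma IsAdmissible.sum_norm_pow_sq_le {A : Matrix (Fin n) (Fin n) ℝ} {B : Matrix (Fin n) (Fin p) ℝ}
    {C : Matrix (Fin m) (Fin n) ℝ} {σw σz : ℝ} {S : Matrix (Fin n) (Fin n) ℝ}
    (h : IsAdmissible A B C σw σz S) (K : ℕ) :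
    ∑ k ∈ Finset.range K, ‖(A - kalmanGain A C S σz * C) ^ k‖ ^ 2 ≤ S.trace / σw ^ 2 := by
  have hσ : 0 < σw ^ 2 := by have := h.σw_pos; positivity
  rw [le_div_iff₀' hσ]
  refine SysId.sum_norm_pow_sq_le h.posSemidef ?_ h.lyapunov hσ.le K
  have := Matrix.posSemidef_self_mul_conjTranspose (kalmanGain A C S σz)
  rw [Matrix.conjTranspose_eq_transpose_of_trivial] at this
  exact this.smul (sq_nonneg σz)

lemma mul_transpose_mulVec_sq_le (X : Matrix (Fin n) (Fin n) ℝ) (F : Matrix (Fin n) (Fin q) ℝ)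
    (y : Fin n → ℝ) :
    ((X * F)ᵀ *ᵥ y) ⬝ᵥ ((X * F)ᵀ *ᵥ y) ≤ ‖F‖ ^ 2 * ‖X‖ ^ 2 * (y ⬝ᵥ y) := by
  refine (mulVec_sq_le _ y).trans ?_
  rw [norm_transpose, mul_comm (‖F‖ ^ 2), ← mul_pow]
  have := dotProduct_self_nonneg y
  gcongr
  exact Matrix.l2_opNorm_mul _ _

lemma norm_obsvMatrix_sq_le (A : Matrix (Fin n) (Fin n) ℝ) (C : Matrix (Fin q) (Fin n) ℝ) {c : ℝ}
    (hc : ∀ K, ∑ k ∈ Finset.range K, ‖A ^ k‖ ^ 2 ≤ c) (d : ℕ) :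
    ‖obsvMatrix A C d‖ ^ 2 ≤ ‖C‖ ^ 2 * c := by
  have hc0 : 0 ≤ c := by simpa using hc 0
  refine norm_sq_le_of_mulVec_sq_le _ (by positivity) fun x => ?_
  rw [obsvMatrix_mulVec_sq]
  have hx := dotProduct_self_nonneg x
  calc _ ≤ ∑ k ∈ Finset.range d, ‖C‖ ^ 2 * ‖A ^ k‖ ^ 2 * (x ⬝ᵥ x) :=
        Finset.sum_le_sum fun k _ => (mulVec_sq_le _ x).trans (by
          rw [← mul_pow]; gcongr; exact Matrix.l2_opNorm_mul _ _)
    _ = ‖C‖ ^ 2 * (∑ k ∈ Finset.range d, ‖A ^ k‖ ^ 2) * (x ⬝ᵥ x) := by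
        rw [Finset.mul_sum, Finset.sum_mul]
    _ ≤ _ := by gcongr; exact hc d

lemma norm_reachMatrix_sq_le (A : Matrix (Fin n) (Fin n) ℝ) (B : Matrix (Fin n) (Fin p) ℝ)
    (F : Matrix (Fin n) (Fin m) ℝ) {c : ℝ}
    (hc : ∀ K, ∑ k ∈ Finset.range K, ‖A ^ k‖ ^ 2 ≤ c) (d : ℕ) :
    ‖reachMatrix A B F d‖ ^ 2 ≤ (‖F‖ ^ 2 + ‖B‖ ^ 2) * c := by
  have hc0 : 0 ≤ c := by simpa using hc 0
  rw [← norm_transpose]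
  refine norm_sq_le_of_mulVec_sq_le _ (by positivity) fun y => ?_
  rw [reachMatrix_transpose_mulVec_sq]
  have hy := dotProduct_self_nonneg y
  calc _ ≤ ∑ k ∈ Finset.range d, (‖F‖ ^ 2 + ‖B‖ ^ 2) * ‖A ^ k‖ ^ 2 * (y ⬝ᵥ y) :=
        Finset.sum_le_sum fun k _ => by
          have h1 := mul_transpose_mulVec_sq_le (A ^ k) F y
          have h2 := mul_transpose_mulVec_sq_le (A ^ k) B y
          linarith
    _ = (‖F‖ ^ 2 + ‖B‖ ^ 2) * (∑ k ∈ Finset.range d, ‖A ^ k‖ ^ 2) * (y ⬝ᵥ y) := by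
        rw [Finset.mul_sum, Finset.sum_mul]
    _ ≤ _ := by gcongr; exact hc d

/-- Adding a block to the controllability matrix increases it by a vanishing relative amount. -/
lemma exists_reachMatrix_succ_le {A : Matrix (Fin n) (Fin n) ℝ} {F : Matrix (Fin n) (Fin m) ℝ}
    {B : Matrix (Fin n) (Fin p) ℝ} {c : ℝ} (hc : ∀ K, ∑ k ∈ Finset.range K, ‖A ^ k‖ ^ 2 ≤ c)
    (hinj : ∀ y, (reachMatrix A B F n)ᵀ *ᵥ y = 0 → y = 0) :
    ∃ η : ℕ → ℝ, (∃ b, 0 ≤ b ∧ ∀ d, η d ≤ b) ∧ (∀ d, 0 ≤ η d) ∧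
      Filter.Tendsto η Filter.atTop (nhds 0) ∧
      ∀ d, n ≤ d → ∀ y, ((reachMatrix A B F (d + 1))ᵀ *ᵥ y) ⬝ᵥ ((reachMatrix A B F (d + 1))ᵀ *ᵥ y)
        ≤ (1 + η d) * (((reachMatrix A B F d)ᵀ *ᵥ y) ⬝ᵥ ((reachMatrix A B F d)ᵀ *ᵥ y)) := by
  obtain ⟨w, hw, hwy⟩ := exists_pos_mul_le_mulVec_sq _ hinj
  have hc0 : 0 ≤ c := by simpa using hc 0
  have hsum : Summable fun k => ‖A ^ k‖ ^ 2 :=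
    summable_of_sum_range_le (fun k => by positivity) hc
  set g := ‖F‖ ^ 2 + ‖B‖ ^ 2 with hg
  -- The new block adds at most `g ‖A ^ d‖² |y|²`, while the first `n` blocks already contribute at
  -- least `w |y|²`.
  refine ⟨fun d => g / w * ‖A ^ d‖ ^ 2, ⟨g / w * c, by positivity, fun d => ?_⟩,
    fun d => by positivity, ?_, fun d hd y => ?_⟩
  · have : ‖A ^ d‖ ^ 2 ≤ c := by
      refine le_trans ?_ (hc (d + 1))
      exact Finset.single_le_sum (f := fun k => ‖A ^ k‖ ^ 2) (fun k _ => by positivity)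
        (Finset.self_mem_range_succ d)
    exact mul_le_mul_of_nonneg_left this (by positivity)
  · simpa using hsum.tendsto_atTop_zero.const_mul (g / w)
  · have h1 : w * (y ⬝ᵥ y) ≤ ((reachMatrix A B F d)ᵀ *ᵥ y) ⬝ᵥ ((reachMatrix A B F d)ᵀ *ᵥ y) := by
      refine (hwy y).trans ?_
      rw [reachMatrix_transpose_mulVec_sq, reachMatrix_transpose_mulVec_sq]
      exact Finset.sum_le_sum_of_subset_of_nonneg (Finset.range_mono hd) fun k _ _ =>
        add_nonneg (dotProduct_self_nonneg _) (dotProduct_self_nonneg _)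
    have h2 : ((reachMatrix A B F (d + 1))ᵀ *ᵥ y) ⬝ᵥ ((reachMatrix A B F (d + 1))ᵀ *ᵥ y)
        ≤ ((reachMatrix A B F d)ᵀ *ᵥ y) ⬝ᵥ ((reachMatrix A B F d)ᵀ *ᵥ y)
          + g * ‖A ^ d‖ ^ 2 * (y ⬝ᵥ y) := by
      rw [reachMatrix_transpose_mulVec_sq, reachMatrix_transpose_mulVec_sq, Finset.sum_range_succ]
      have h1 := mul_transpose_mulVec_sq_le (A ^ d) F y
      have h2 := mul_transpose_mulVec_sq_le (A ^ d) B y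
      rw [hg]; linarith
    have h3 : g * ‖A ^ d‖ ^ 2 * (y ⬝ᵥ y) = g / w * ‖A ^ d‖ ^ 2 * (w * (y ⬝ᵥ y)) := by
      field_simp
    have h4 := mul_le_mul_of_nonneg_left h1 (show 0 ≤ g / w * ‖A ^ d‖ ^ 2 by positivity)
    rw [h3] at h2
    change _ ≤ (1 + g / w * ‖A ^ d‖ ^ 2) * _
    linarith

end System

/-! ### Deterministic perturbation bounds for the output of the procedure. -/

section Output

variable {ι κ : Type*} [Fintype ι] [Fintype κ] [DecidableEq ι] [DecidableEq κ]
  {n m p d₁ d₂ He : ℕ}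

lemma diagonal_sqrt_mul_self {s : Fin n → ℝ} (hs : ∀ i, 0 ≤ s i) :
    Matrix.diagonal (fun i => √(s i)) * Matrix.diagonal (fun i => √(s i)) = Matrix.diagonal s := by
  rw [Matrix.diagonal_mul_diagonal]
  congr 1; ext i; exact Real.mul_self_sqrt (hs i)

lemma transpose_mul_self_sqrt {U : Matrix ι (Fin n) ℝ} (hU : Uᵀ * U = 1) {s : Fin n → ℝ}
    (hs : ∀ i, 0 ≤ s i) :
    (U * Matrix.diagonal fun i => √(s i))ᵀ * (U * Matrix.diagonal fun i => √(s i))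
      = Matrix.diagonal s := by
  rw [Matrix.transpose_mul, Matrix.diagonal_transpose, Matrix.mul_assoc, ← Matrix.mul_assoc Uᵀ, hU,
    Matrix.one_mul, diagonal_sqrt_mul_self hs]

lemma IsSVD.norm_diagonal_le {N : Matrix ι κ ℝ} {U : Matrix ι (Fin n) ℝ} {s : Fin n → ℝ}
    {V : Matrix κ (Fin n) ℝ} (h : IsSVD N U s V) : ‖Matrix.diagonal s‖ ≤ ‖N‖ := by
  have h1 : Matrix.diagonal s = Uᵀ * N * V := by
    rw [Matrix.mul_assoc, h.mul_right, ← Matrix.mul_assoc, h.orthU, Matrix.one_mul]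
  have hU := norm_le_one_of_transpose_mul_self h.orthU
  rw [← norm_transpose] at hU
  have hV := norm_le_one_of_transpose_mul_self h.orthV
  rw [h1]
  calc _ ≤ ‖Uᵀ * N‖ * ‖V‖ := Matrix.l2_opNorm_mul _ _
    _ ≤ ‖Uᵀ‖ * ‖N‖ * ‖V‖ := by gcongr; exact Matrix.l2_opNorm_mul _ _
    _ ≤ 1 * ‖N‖ * 1 := by gcongr
    _ = ‖N‖ := by ring

lemma norm_sq_eq_of_transpose_mul_self {M : Matrix ι κ ℝ} {D : Matrix κ κ ℝ} (h : Mᵀ * M = D) :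
    ‖M‖ ^ 2 = ‖D‖ := by
  rw [← h, ← Matrix.conjTranspose_eq_transpose_of_trivial, Matrix.l2_opNorm_conjTranspose_mul_self,
    sq]

lemma IsMoorePenrose.of_gram_diagonal {M : Matrix ι (Fin n) ℝ} {P : Matrix (Fin n) ι ℝ}
    (h : IsMoorePenrose M P) {s : Fin n → ℝ} (hM : Mᵀ * M = Matrix.diagonal s) {c : ℝ} (hc : 0 < c)
    (hs : ∀ i, c ≤ s i) : P * M = 1 ∧ ‖P‖ ^ 2 ≤ c⁻¹ := by
  refine ⟨h.mul_eq_one ?_, h.norm_sq_le hc fun x => ?_⟩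
  · rw [hM, Matrix.isUnit_iff_isUnit_det, Matrix.det_diagonal, isUnit_iff_ne_zero]
    exact Finset.prod_ne_zero_iff.2 fun i _ => (hc.trans_le (hs i)).ne'
  · rw [mulVec_dotProduct_mulVec, hM, dotProduct, dotProduct, Finset.mul_sum]
    refine Finset.sum_le_sum fun i _ => ?_
    rw [Matrix.mulVec_diagonal]
    have := mul_le_mul_of_nonneg_right (hs i) (mul_self_nonneg (x i))
    linarith

/-- Moore-Penrose inverses of a factor and of a perturbation of its rotation. -/
lemma IsMoorePenrose.rotate_bounds {M M' : Matrix ι (Fin n) ℝ} {P P' : Matrix (Fin n) ι ℝ}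
    (h : IsMoorePenrose M P) (h' : IsMoorePenrose M' P') {s s' : Fin n → ℝ}
    (hM : Mᵀ * M = Matrix.diagonal s) (hM' : M'ᵀ * M' = Matrix.diagonal s')
    {Q : Matrix (Fin n) (Fin n) ℝ} (hQ : Q ∈ Matrix.orthogonalGroup (Fin n) ℝ)
    {τ a ρ : ℝ} (hτ : 0 < τ) (ha : 0 < a) (haτ : a ^ 2 * τ = 1) (hs : ∀ i, τ ≤ s i)
    (hs' : ∀ i, τ / 4 ≤ s' i) (hρ : ‖M' - M * Q‖ ≤ ρ) :
    ‖Qᵀ * P‖ ≤ a ∧ ‖P'‖ ≤ 2 * a ∧ ‖P' - Qᵀ * P‖ ≤ 6 * a ^ 2 * ρ := by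
  obtain ⟨-, h1⟩ := h.of_gram_diagonal hM hτ hs
  obtain ⟨h2, h3⟩ := h'.of_gram_diagonal hM' (by positivity) hs'
  have e1 : τ⁻¹ = a ^ 2 := by field_simp; linarith
  have hP : ‖P‖ ≤ a := by
    rw [e1] at h1
    exact le_of_sq_le_sq h1 ha.le
  have hP' : ‖P'‖ ≤ 2 * a := by
    have e2 : (τ / 4)⁻¹ = (2 * a) ^ 2 := by rw [mul_pow, ← e1]; field_simp; norm_num
    rw [e2] at h3
    exact le_of_sq_le_sq h3 (by positivity)
  have hQn : ‖Qᵀ‖ ≤ 1 := by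
    rw [norm_transpose]
    exact norm_le_one_of_transpose_mul_self ((Matrix.mem_orthogonalGroup_iff' _ ℝ).1 hQ)
  have hQP : ‖Qᵀ * P‖ ≤ a := by
    calc _ ≤ ‖Qᵀ‖ * ‖P‖ := Matrix.l2_opNorm_mul _ _
      _ ≤ 1 * a := by gcongr
      _ = a := one_mul a
  refine ⟨hQP, hP', ((h.mul_orthogonal hQ).norm_sub_le h' h2).trans ?_⟩
  have hρ0 : 0 ≤ ρ := (norm_nonneg _).trans hρ
  -- Here `a = τ^(-1/2)` bounds the true inverse, and `2 * a` the perturbed one because `s' ≥ τ /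
  -- 4`.
  calc _ ≤ ρ * (2 * a * a + (2 * a) ^ 2) := by gcongr
    _ = 6 * a ^ 2 * ρ := by ring

/-- Deterministic perturbation bound for the procedure. -/
lemma IsOutput.exists_orthogonal (h : d₁ + d₂ + 1 = He) (hd₁ : 0 < d₁) (hd₂ : 0 < d₂)
    {G G' : Matrix (Fin m) (Cols He m p) ℝ}
    {A A' : Matrix (Fin n) (Fin n) ℝ} {B B' : Matrix (Fin n) (Fin p) ℝ}
    {C C' : Matrix (Fin m) (Fin n) ℝ} {F F' : Matrix (Fin n) (Fin m) ℝ}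
    (hout : IsOutput h hd₁ hd₂ G A B C F) (hout' : IsOutput h hd₁ hd₂ G' A' B' C' F')
    {X : Matrix (Fin d₁ × Fin m) (Fin n) ℝ} {Y : Matrix (Fin n) (Cols d₂ m p) ℝ}
    (hXY : hankelMinus (hankel h G) = X * Y) {τ e ρ a ℓ : ℝ} (hτ : 0 < τ)
    (hsv : ∀ (U : Matrix (Fin d₁ × Fin m) (Fin n) ℝ) (s : Fin n → ℝ)
      (V : Matrix (Cols d₂ m p) (Fin n) ℝ), IsSVD (X * Y) U s V → ∀ i, τ ≤ s i)
    (he : ‖hankelMinus (hankel h G') - hankelMinus (hankel h G)‖ ≤ e) (heτ : e ≤ 3 / 8 * τ)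
    (hρ0 : 0 ≤ ρ) (hρ : 15 * n * e ^ 2 ≤ τ * ρ ^ 2) (ha : 0 < a) (haτ : a ^ 2 * τ = 1)
    (hℓ : 0 ≤ ℓ) (hN : ‖hankelMinus (hankel h G)‖ ≤ ℓ ^ 2) :
    ∃ Q ∈ Matrix.orthogonalGroup (Fin n) ℝ,
      ‖A' - Qᵀ * A * Q‖ ≤ 6 * a ^ 3 * ρ * ‖hankelPlus (hankel h G)‖
          + 2 * a ^ 2 * ‖hankelPlus (hankel h G') - hankelPlus (hankel h G)‖
          + 12 * a ^ 3 * ρ * ‖hankelPlus (hankel h G')‖ + ρ * (2 * ℓ + ρ) ∧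
      ‖B' - Qᵀ * B‖ ≤ ρ ∧ ‖C' - C * Q‖ ≤ ρ ∧ ‖F' - Qᵀ * F‖ ≤ ρ := by
  obtain ⟨N, U, s, V, O, R, P, W, Ab, ht, hsvd, hO, hR, hC, hB, hF, hP, hW, hAb, hA⟩ := hout
  obtain ⟨N', U', s', V', O', R', P', W', Ab', ht', hsvd', hO', hR', hC', hB', hF', hP', hW', hAb',
    hA'⟩ := hout'
  set M := hankelMinus (hankel h G)
  set M' := hankelMinus (hankel h G')
  have hNM : N = M := ht.eq_of_eq_mul hXY
  subst hNM
  have hs : ∀ i, τ ≤ s i := hsv U s V (by rw [← hXY]; exact hsvd)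
  have he' : ‖M' - N'‖ ≤ e := by
    refine (ht'.norm_sub_le X Y).trans ?_
    rw [← hXY]; exact he
  -- Truncation costs at most another `e`, since the rank-`n` product `X * Y` is a competitor; the
  -- total `2 e ≤ 3 τ / 4` leaves `τ / 4` for the perturbed singular values.
  have hdist : ‖N' - M‖ ≤ 3 / 4 * τ := by
    have : N' - M = (M' - M) - (M' - N') := by abel
    rw [this]
    linarith [norm_sub_le (M' - M) (M' - N')]
  have hs' : ∀ i, τ / 4 ≤ s' i := fun i => by
    have := hsvd.sub_norm_le hsvd' hs (by linarith) i
    linarith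
  have hs'0 : ∀ i, 0 < s' i := fun i => lt_of_lt_of_le (by positivity) (hs' i)
  have htr := hsvd.trace_sub_le hsvd' hs'0 he he' ht'.transpose_mul_sub
  have hOO : Oᵀ * O = Matrix.diagonal s := by
    rw [hO]; exact transpose_mul_self_sqrt hsvd.orthU hsvd.nonneg
  have hOO' : O'ᵀ * O' = Matrix.diagonal s' := by
    rw [hO']; exact transpose_mul_self_sqrt hsvd'.orthU hsvd'.nonneg
  have hRt : Rᵀ = V * Matrix.diagonal fun i => √(s i) := by rw [hR]; simp
  have hRt' : R'ᵀ = V' * Matrix.diagonal fun i => √(s' i) := by rw [hR']; simp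
  have hRR : Rᵀᵀ * Rᵀ = Matrix.diagonal s := by
    rw [hRt]; exact transpose_mul_self_sqrt hsvd.orthV hsvd.nonneg
  have hRR' : R'ᵀᵀ * R'ᵀ = Matrix.diagonal s' := by
    rw [hRt']; exact transpose_mul_self_sqrt hsvd'.orthV hsvd'.nonneg
  have hOR : O * R = M := by
    rw [hO, hR, Matrix.mul_assoc, ← Matrix.mul_assoc (Matrix.diagonal _),
      diagonal_sqrt_mul_self hsvd.nonneg, ← Matrix.mul_assoc, ← hsvd.eq]
  have hOR' : O' * R' = N' := by
    rw [hO', hR', Matrix.mul_assoc, ← Matrix.mul_assoc (Matrix.diagonal _),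
      diagonal_sqrt_mul_self hsvd'.nonneg, ← Matrix.mul_assoc, ← hsvd'.eq]
  obtain ⟨Q, hQ, hpro⟩ := exists_orthogonal_trace_le hOO hRR hOO' hRR' hs
  simp only [Matrix.transpose_transpose, hOR, hOR'] at hpro
  have hQQ : Q * Qᵀ = 1 := (Matrix.mem_orthogonalGroup_iff _ ℝ).1 hQ
  have hΔO := trace_transpose_mul_self_nonneg (O' - O * Q)
  have hΔR := trace_transpose_mul_self_nonneg (R' - Qᵀ * R)ᵀ
  rw [Matrix.transpose_transpose] at hΔR
  -- The 15 in `hρ` is the 3 of the Procrustes bound times the 5 of the truncation bound.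
  have hsum : ((O' - O * Q)ᵀ * (O' - O * Q)).trace + ((R' - Qᵀ * R) * (R' - Qᵀ * R)ᵀ).trace
      ≤ ρ ^ 2 := by
    refine le_of_mul_le_mul_left ?_ hτ
    linarith
  have hOρ : ‖O' - O * Q‖ ≤ ρ :=
    le_of_sq_le_sq ((norm_sq_le_trace _).trans (by linarith)) hρ0
  have hRρ : ‖R' - Qᵀ * R‖ ≤ ρ := by
    rw [← norm_transpose]
    refine le_of_sq_le_sq ((norm_sq_le_trace _).trans ?_) hρ0
    rw [Matrix.transpose_transpose]; linarith
  have hBρ : ‖B' - Qᵀ * B‖ ≤ ρ := by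
    rw [hB, hB']
    exact (norm_submatrix_cols_le (R' - Qᵀ * R) (f := fun b => Sum.inr (⟨0, hd₂⟩, b))
      (fun b c hbc => by simpa using hbc)).trans hRρ
  have hFρ : ‖F' - Qᵀ * F‖ ≤ ρ := by
    rw [hF, hF']
    exact (norm_submatrix_cols_le (R' - Qᵀ * R) (f := fun b => Sum.inl (⟨0, hd₂⟩, b))
      (fun b c hbc => by simpa using hbc)).trans hRρ
  have hCρ : ‖C' - C * Q‖ ≤ ρ := by
    rw [hC, hC']
    exact (norm_submatrix_rows_le (O' - O * Q) (f := fun b => (⟨0, hd₁⟩, b))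
      (fun b c hbc => by simpa using hbc)).trans hOρ
  refine ⟨Q, hQ, ?_, hBρ, hCρ, hFρ⟩
  obtain ⟨hP1, hP2, hP3⟩ := hP.rotate_bounds hP' hOO hOO' hQ hτ ha haτ hs hs' hOρ
  obtain ⟨hW1, hW2, hW3⟩ := hW.transpose.rotate_bounds hW'.transpose hRR hRR' hQ hτ ha haτ hs hs'
    (ρ := ρ) (by
      rw [← norm_transpose, Matrix.transpose_sub, Matrix.transpose_mul]
      simpa using hRρ)
  have eW : Qᵀ * Wᵀ = (W * Q)ᵀ := by rw [Matrix.transpose_mul]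
  rw [eW, norm_transpose] at hW1
  rw [norm_transpose] at hW2
  rw [eW, ← Matrix.transpose_sub, norm_transpose] at hW3
  have hQn : ‖Q‖ ≤ 1 :=
    norm_le_one_of_transpose_mul_self ((Matrix.mem_orthogonalGroup_iff' _ ℝ).1 hQ)
  have hdiag := hsvd.norm_diagonal_le.trans hN
  have hOn : ‖O‖ ≤ ℓ :=
    le_of_sq_le_sq ((norm_sq_eq_of_transpose_mul_self hOO).trans_le hdiag) hℓ
  have hRn : ‖R‖ ≤ ℓ := by
    rw [← norm_transpose]
    exact le_of_sq_le_sq ((norm_sq_eq_of_transpose_mul_self hRR).trans_le hdiag) hℓ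
  have hCn : ‖C * Q‖ ≤ ℓ := by
    have h1 : ‖C‖ ≤ ‖O‖ := by
      rw [hC]
      exact norm_submatrix_rows_le O (f := fun b => (⟨0, hd₁⟩, b))
        (fun b c hbc => by simpa using hbc)
    calc ‖C * Q‖ ≤ ‖C‖ * ‖Q‖ := Matrix.l2_opNorm_mul _ _
      _ ≤ ℓ * 1 := by gcongr; exact h1.trans hOn
      _ = ℓ := mul_one ℓ
  have hFn : ‖Qᵀ * F‖ ≤ ℓ := by
    have h1 : ‖F‖ ≤ ‖R‖ := by
      rw [hF]
      exact norm_submatrix_cols_le R (f := fun b => Sum.inl (⟨0, hd₂⟩, b))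
        (fun b c hbc => by simpa using hbc)
    calc ‖Qᵀ * F‖ ≤ ‖Qᵀ‖ * ‖F‖ := Matrix.l2_opNorm_mul _ _
      _ ≤ 1 * ℓ := by rw [norm_transpose]; gcongr; exact h1.trans hRn
      _ = ℓ := one_mul ℓ
  set Hp := hankelPlus (hankel h G)
  set Hp' := hankelPlus (hankel h G')
  -- Conjugation by `Q` turns the true factors into the rotated ones, so each term compares
  -- quantities already known to be close.
  have hsplit : A' - Qᵀ * A * Q = (P' * Hp' * W' - (Qᵀ * P) * Hp * (W * Q))
      + ((F' - Qᵀ * F) * C' + (Qᵀ * F) * (C' - C * Q)) := by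
    have h1 : Qᵀ * A * Q = (Qᵀ * P) * Hp * (W * Q) + (Qᵀ * F) * (C * Q) := by
      rw [hA, hAb, Matrix.mul_add, Matrix.add_mul]; simp only [Matrix.mul_assoc]
    rw [h1, hA', hAb', Matrix.sub_mul, Matrix.mul_sub]
    abel
  have hC'n : ‖C'‖ ≤ ℓ + ρ := by
    have : C' = C * Q + (C' - C * Q) := by abel
    rw [this]
    exact (norm_add_le _ _).trans (add_le_add hCn hCρ)
  have hFC : ‖(F' - Qᵀ * F) * C' + (Qᵀ * F) * (C' - C * Q)‖ ≤ ρ * (2 * ℓ + ρ) := by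
    calc _ ≤ ‖(F' - Qᵀ * F) * C'‖ + ‖(Qᵀ * F) * (C' - C * Q)‖ := norm_add_le _ _
      _ ≤ ‖F' - Qᵀ * F‖ * ‖C'‖ + ‖Qᵀ * F‖ * ‖C' - C * Q‖ :=
          add_le_add (Matrix.l2_opNorm_mul _ _) (Matrix.l2_opNorm_mul _ _)
      _ ≤ ρ * (ℓ + ρ) + ℓ * ρ := by gcongr
      _ = _ := by ring
  rw [hsplit]
  refine (norm_add_le _ _).trans (add_le_add ((norm_mul_mul_sub_le _ _ _ _ _ _).trans ?_) hFC)
  calc _ ≤ 6 * a ^ 2 * ρ * ‖Hp‖ * a + 2 * a * ‖Hp' - Hp‖ * a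
        + 2 * a * ‖Hp'‖ * (6 * a ^ 2 * ρ) := by gcongr
    _ = _ := by ring

end Output

/-! ### System-dependent constants and the final bounds. -/

section Main

variable {n m p d₁ d₂ He : ℕ}

lemma IsAdmissible.pos_of_pos {A : Matrix (Fin n) (Fin n) ℝ} {B : Matrix (Fin n) (Fin p) ℝ}
    {C : Matrix (Fin m) (Fin n) ℝ} {σw σz : ℝ} {S : Matrix (Fin n) (Fin n) ℝ}
    (h : IsAdmissible A B C σw σz S) (hn : 0 < n) : 0 < m := by
  rcases Nat.eq_zero_or_pos m with rfl | hm
  · have := h.observable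
    have h2 := (obsvMatrix A C n).rank_le_card_height
    rw [IsObservable] at this
    simp at h2
    omega
  · exact hm

/-- The factorization of the Hankel matrices of an admissible system, with bounds that do not
depend on the numbers of blocks. -/
lemma IsAdmissible.exists_bounds {A : Matrix (Fin n) (Fin n) ℝ} {B : Matrix (Fin n) (Fin p) ℝ}
    {C : Matrix (Fin m) (Fin n) ℝ} {σw σz : ℝ} {S : Matrix (Fin n) (Fin n) ℝ}
    (hΘ : IsAdmissible A B C σw σz S) :
    ∃ (L b : ℝ) (η : ℕ → ℝ), 0 < L ∧ 0 ≤ b ∧ (∀ d, 0 ≤ η d ∧ η d ≤ b) ∧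
      Filter.Tendsto η Filter.atTop (nhds 0) ∧
      ∀ (He d₁ d₂ : ℕ) (h : d₁ + d₂ + 1 = He), n ≤ d₁ → n ≤ d₂ →
        ∀ H, H = hankel h (arxMatrix A B C (kalmanGain A C S σz) He) →
        H.rank = n ∧ ‖H‖ ≤ L ^ 2 ∧
        ∃ (X : Matrix (Fin d₁ × Fin m) (Fin n) ℝ) (Y : Matrix (Fin n) (Cols d₂ m p) ℝ),
          hankelMinus H = X * Y ∧
          ∀ (U : Matrix (Fin d₁ × Fin m) (Fin n) ℝ) (s : Fin n → ℝ)
            (V : Matrix (Cols d₂ m p) (Fin n) ℝ), IsSVD (X * Y) U s V →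
            ∀ i, sigma n H ^ 2 ≤ (1 + η d₂) * s i ^ 2 := by
  set F := kalmanGain A C S σz with hF
  have hc := hΘ.sum_norm_pow_sq_le
  rw [← hF] at hc
  set c := S.trace / σw ^ 2
  have hc0 : 0 ≤ c := by simpa using hc 0
  have hinj : ∀ d, n ≤ d → ∀ y, (reachMatrix (A - F * C) B F d)ᵀ *ᵥ y = 0 → y = 0 :=
    fun d hd => reachMatrix_sub_mul_injective hΘ.controllable_F C B hd
  obtain ⟨η, ⟨b, hb, hηb⟩, hη0, hηt, hη⟩ := exists_reachMatrix_succ_le (B := B) hc (hinj n le_rfl)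
  set g := (‖C‖ ^ 2 * c) * ((‖F‖ ^ 2 + ‖B‖ ^ 2) * c) with hg
  have hg0 : 0 ≤ g := by positivity
  -- `g` bounds `‖H‖²`, and `g ≤ (g + 1) ^ 4`; adding 1 keeps `L` positive.
  refine ⟨g + 1, b, η, by linarith, hb, fun d => ⟨hη0 d, hηb d⟩, hηt, ?_⟩
  rintro He d₁ d₂ h hd₁ hd₂ H rfl
  have hobs := obsvMatrix_sub_mul_injective hΘ.observable F hd₁
  have hH := hankel_arxMatrix h A B C F
  refine ⟨?_, ?_, obsvMatrix (A - F * C) C d₁, reachMatrix (A - F * C) B F d₂, ?_, ?_⟩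
  · rw [hH, rank_mul_eq_card hobs (hinj _ (by omega)), Fintype.card_fin]
  · have h1 := norm_obsvMatrix_sq_le (A - F * C) C hc d₁
    have h2 := norm_reachMatrix_sq_le (A - F * C) B F hc (d₂ + 1)
    have h3 : ‖hankel h (arxMatrix A B C F He)‖ ^ 2 ≤ g := by
      rw [hH, hg]
      calc _ ≤ (‖obsvMatrix (A - F * C) C d₁‖ * ‖reachMatrix (A - F * C) B F (d₂ + 1)‖) ^ 2 := by
            gcongr; exact Matrix.l2_opNorm_mul _ _
        _ ≤ _ := by rw [mul_pow]; gcongr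
    refine le_of_sq_le_sq (h3.trans ?_) (by positivity)
    have h4 : 1 ≤ (g + 1) ^ 3 := one_le_pow₀ (by linarith)
    calc g ≤ (g + 1) * 1 := by linarith
      _ ≤ (g + 1) * (g + 1) ^ 3 := by gcongr
      _ = ((g + 1) ^ 2) ^ 2 := by ring
  · rw [hH, hankelMinus_mul_reachMatrix]
  · intro U s V hs i
    rw [hH]
    exact hs.sigma_sq_le hobs (hinj _ hd₂) (hinj _ (by omega)) (hη d₂ hd₂) i

/-- The data dependent part of the horizon bound forces the number of blocks to be large. -/
lemma exists_const_le_log_div {m : ℕ} (hm : 0 < m) {lam υ : ℝ} (hlam : 0 < lam) (hυ : 0 < υ)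
    (hυ1 : υ < 1) (x : ℝ) : ∃ cH : ℝ, 0 < cH ∧ ∀ T : ℕ, 1 ≤ T →
      x ≤ Real.log (cH * (T : ℝ) ^ 2 * √(m : ℝ) / √lam) / Real.log (1 / υ) := by
  have hlog : 0 < Real.log (1 / υ) := Real.log_pos (by rw [lt_div_iff₀ hυ]; linarith)
  have hsl : 0 < √lam := Real.sqrt_pos.2 hlam
  -- Chosen so that the quotient is exactly `x` when `T² √m = 1`; since `T, m ≥ 1`, it can only be
  -- larger.
  refine ⟨√lam * Real.exp (x * Real.log (1 / υ)), by positivity, fun T hT => ?_⟩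
  rw [le_div_iff₀ hlog]
  have hT1 : (1 : ℝ) ≤ (T : ℝ) ^ 2 := one_le_pow₀ (by exact_mod_cast hT)
  have hm1 : (1 : ℝ) ≤ √(m : ℝ) := Real.one_le_sqrt.2 (by exact_mod_cast hm)
  have hE := Real.exp_pos (x * Real.log (1 / υ))
  have h1 : √lam * Real.exp (x * Real.log (1 / υ)) * (T : ℝ) ^ 2 * √(m : ℝ) / √lam
      = Real.exp (x * Real.log (1 / υ)) * ((T : ℝ) ^ 2 * √(m : ℝ)) := by
    field_simp
  have h2 : (1 : ℝ) ≤ (T : ℝ) ^ 2 * √(m : ℝ) := one_le_mul_of_one_le_of_one_le hT1 hm1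
  rw [h1, Real.le_log_iff_exp_le (by positivity)]
  exact le_mul_of_one_le_right hE.le h2

/-- The waiting time turns the rate of the estimates into a bound at that time. -/
lemma sq_le_of_le_sqrt_div {TG t ε c d : ℝ} (ht : 0 ≤ t) (hTG : 0 ≤ TG) (hε0 : 0 ≤ ε)
    (hε : ε ≤ √(TG / t)) (hc : 0 < c) (hd : 0 < d) (h : TG * (c / d) ≤ t) : c * ε ^ 2 ≤ d := by
  have h1 : ε ^ 2 ≤ TG / t := by
    calc ε ^ 2 ≤ √(TG / t) ^ 2 := pow_le_pow_left₀ hε0 hε 2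
      _ = TG / t := Real.sq_sqrt (by positivity)
  -- At `t = 0` the convention `TG / 0 = 0` makes the assumed rate force `ε = 0`.
  rcases ht.eq_or_lt with rfl | ht
  · rw [div_zero] at h1
    have : ε ^ 2 = 0 := le_antisymm h1 (sq_nonneg ε)
    rw [this]; linarith
  · rw [le_div_iff₀ ht] at h1
    have h2 : TG * c ≤ t * d := by
      rw [← mul_div_assoc, div_le_iff₀ hd] at h
      exact h
    have h3 : t * (c * ε ^ 2) ≤ t * d := by
      calc t * (c * ε ^ 2) = c * (ε ^ 2 * t) := by ring
        _ ≤ c * TG := by gcongr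
        _ ≤ t * d := by linarith
    exact le_of_mul_le_mul_left h3 ht

/-- Bookkeeping of the constants in the bound for the state matrix. -/
lemma state_bound_le {k K σ hn L ε q r a ρ x y z : ℝ} (hk : 1 ≤ k) (hkK : k ^ 2 ≤ K) (hL : 0 < L)
    (hr : 0 < r) (hrσ : r ^ 2 * σ = 1) (hσ : 0 < σ) (hσh : σ ≤ hn) (hhL : hn ≤ L ^ 2)
    (hε : 0 ≤ ε) (hq : 0 ≤ q) (ha : 0 < a) (hak : a ^ 2 = k * r ^ 2) (hρ0 : 0 ≤ ρ)
    (hρ : ρ ≤ 5 * q * r * ε) (hρ1 : ρ ≤ 1) (hx : x ≤ hn) (hy : y ≤ q * ε) (hz : z ≤ hn + σ) :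
    6 * a ^ 3 * ρ * x + 2 * a ^ 2 * y + 12 * a ^ 3 * ρ * z + ρ * (2 * L + ρ)
      ≤ (92 * K + 5 * (2 * L + 1) * L) * (q * (hn + σ) / σ ^ 2) * ε := by
  have hk0 : 0 ≤ k := by linarith
  have hhn : 0 ≤ hn := by linarith
  have hakr : a ≤ k * r := by
    refine le_of_sq_le_sq ?_ (by positivity)
    rw [hak, mul_pow]
    have : k ≤ k ^ 2 := by nlinarith
    gcongr
  have ha3 : a ^ 3 ≤ K * r ^ 3 := by
    calc a ^ 3 = a ^ 2 * a := by ring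
      _ ≤ k * r ^ 2 * (k * r) := by rw [hak]; gcongr
      _ = k ^ 2 * r ^ 3 := by ring
      _ ≤ K * r ^ 3 := by gcongr
  have hK0 : 0 ≤ K := (sq_nonneg k).trans hkK
  have hkK' : k ≤ K := by nlinarith
  have hr4 : r ^ 4 = 1 / σ ^ 2 := by
    rw [eq_div_iff (by positivity)]
    calc r ^ 4 * σ ^ 2 = (r ^ 2 * σ) ^ 2 := by ring
      _ = 1 := by rw [hrσ]; norm_num
  -- The term from `F * C` scales like `r = σ^(-1/2)` only; `σ ≤ L²` trades the missing powers of
  -- `r` for a factor `L`.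
  have hrL : 1 ≤ r * L := by
    refine le_of_sq_le_sq ?_ (by positivity)
    calc (1 : ℝ) ^ 2 = r ^ 2 * σ := by rw [hrσ]; norm_num
      _ ≤ r ^ 2 * L ^ 2 := by gcongr; linarith
      _ = (r * L) ^ 2 := by ring
  have t1 : 6 * a ^ 3 * ρ * x ≤ 6 * (K * r ^ 3) * (5 * q * r * ε) * (hn + σ) := by
    calc 6 * a ^ 3 * ρ * x ≤ 6 * a ^ 3 * ρ * (hn + σ) := by gcongr; linarith
      _ ≤ _ := by gcongr
  have t3 : 12 * a ^ 3 * ρ * z ≤ 12 * (K * r ^ 3) * (5 * q * r * ε) * (hn + σ) := by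
    calc 12 * a ^ 3 * ρ * z ≤ 12 * a ^ 3 * ρ * (hn + σ) := by gcongr
      _ ≤ _ := by gcongr
  have t2 : 2 * a ^ 2 * y ≤ 2 * K * r ^ 4 * (q * ε) * (hn + σ) := by
    have h1 : r ^ 2 ≤ r ^ 4 * (hn + σ) := by
      calc r ^ 2 = r ^ 2 * (r ^ 2 * σ) := by rw [hrσ, mul_one]
        _ = r ^ 4 * σ := by ring
        _ ≤ r ^ 4 * (hn + σ) := by gcongr; linarith
    calc 2 * a ^ 2 * y ≤ 2 * a ^ 2 * (q * ε) := by gcongr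
      _ ≤ 2 * (K * (r ^ 4 * (hn + σ))) * (q * ε) := by rw [hak]; gcongr
      _ = _ := by ring
  have t4 : ρ * (2 * L + ρ) ≤ 5 * q * ε * (2 * L + 1) * (L * r ^ 4 * (hn + σ)) := by
    have h1 : r ≤ L * r ^ 4 * (hn + σ) := by
      calc r = r * (r ^ 2 * σ) * 1 := by rw [hrσ]; ring
        _ ≤ r * (r ^ 2 * σ) * (r * L) := by gcongr
        _ = L * r ^ 4 * σ := by ring
        _ ≤ _ := by gcongr; linarith
    calc ρ * (2 * L + ρ) ≤ (5 * q * r * ε) * (2 * L + 1) := by gcongr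
      _ = 5 * q * ε * (2 * L + 1) * r := by ring
      _ ≤ _ := by gcongr
  -- 92 is `6 * 5 + 2 + 12 * 5`.
  calc _ ≤ _ := add_le_add (add_le_add (add_le_add t1 t2) t3) t4
    _ = (92 * K + 5 * (2 * L + 1) * L) * (q * (hn + σ) * r ^ 4) * ε := by ring
    _ = _ := by rw [hr4]; ring

/-- Error bounds for the procedure when the error of the truncated Hankel matrix is small compared
with the `n`-th singular value of the full one. -/
lemma IsOutput.error_bounds (hn : 0 < n) (h : d₁ + d₂ + 1 = He) (hd₁ : 0 < d₁) (hd₂ : 0 < d₂)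
    {G G' : Matrix (Fin m) (Cols He m p) ℝ}
    {A A' : Matrix (Fin n) (Fin n) ℝ} {B B' : Matrix (Fin n) (Fin p) ℝ}
    {C C' : Matrix (Fin m) (Fin n) ℝ} {F F' : Matrix (Fin n) (Fin m) ℝ}
    (hout : IsOutput h hd₁ hd₂ G A B C F) (hout' : IsOutput h hd₁ hd₂ G' A' B' C' F')
    {X : Matrix (Fin d₁ × Fin m) (Fin n) ℝ} {Y : Matrix (Fin n) (Cols d₂ m p) ℝ}
    (hXY : hankelMinus (hankel h G) = X * Y) {L b η β σ ε : ℝ} (hL : 0 < L)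
    (hη0 : 0 ≤ η) (hηb : η ≤ b) (hβ0 : 0 ≤ β) (hβη : β * (1 + η) ≤ 9 / 8)
    (hσ : 0 < σ) (hσH : σ ≤ ‖hankel h G‖) (hHL : ‖hankel h G‖ ≤ L ^ 2)
    (hsv : ∀ (U : Matrix (Fin d₁ × Fin m) (Fin n) ℝ) (s : Fin n → ℝ)
      (V : Matrix (Cols d₂ m p) (Fin n) ℝ), IsSVD (X * Y) U s V →
      ∀ i, σ ^ 2 ≤ (1 + η) * s i ^ 2)
    (hε0 : 0 ≤ ε) (hN : 8 * He * ε ^ 2 ≤ σ ^ 2) (hB : 20 * n * He * ε ^ 2 ≤ σ)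
    (heβ : ‖hankelMinus (hankel h G') - hankelMinus (hankel h G)‖ ^ 2 ≤ β * He * ε ^ 2)
    (hyΔ : ‖hankelPlus (hankel h G') - hankelPlus (hankel h G)‖ ^ 2 ≤ He * ε ^ 2) :
    ∃ Q ∈ Matrix.orthogonalGroup (Fin n) ℝ,
      ‖A' - Qᵀ * A * Q‖ ≤ (92 * (1 + b) + 5 * (2 * L + 1) * L) *
        (√(n * He : ℝ) * (‖hankel h G‖ + σ) / σ ^ 2) * ε ∧
      ‖B' - Qᵀ * B‖ ≤ √(20 * n * He / σ) * ε ∧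
      ‖C' - C * Q‖ ≤ √(20 * n * He / σ) * ε ∧
      ‖F' - Qᵀ * F‖ ≤ √(20 * n * He / σ) * ε := by
  have hHe0 : (0 : ℝ) < He := by exact_mod_cast (show 0 < He by omega)
  have hn0 : (0 : ℝ) < n := by exact_mod_cast hn
  set e := ‖hankelMinus (hankel h G') - hankelMinus (hankel h G)‖ with he
  set y := ‖hankelPlus (hankel h G') - hankelPlus (hankel h G)‖ with hy
  set k := √(1 + η) with hk
  have hk2 : k ^ 2 = 1 + η := Real.sq_sqrt (by linarith)
  have hk1 : 1 ≤ k := Real.one_le_sqrt.2 (by linarith)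
  have hk0 : 0 < k := by linarith
  set r := (√σ)⁻¹ with hr
  have hr0 : 0 < r := inv_pos.2 (Real.sqrt_pos.2 hσ)
  have hrσ : r ^ 2 * σ = 1 := by
    rw [hr, inv_pow, Real.sq_sqrt hσ.le, inv_mul_cancel₀ hσ.ne']
  -- By `hsv` this is a lower bound for the singular values of the true `H⁻`.
  set τ := σ / k with hτ
  have hτ0 : 0 < τ := div_pos hσ hk0
  have hτσ : τ * k = σ := div_mul_cancel₀ σ hk0.ne'
  set a := √(k * r ^ 2) with ha
  have ha2 : a ^ 2 = k * r ^ 2 := Real.sq_sqrt (by positivity)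
  have ha0 : 0 < a := Real.sqrt_pos.2 (by positivity)
  have haτ : a ^ 2 * τ = 1 := by
    rw [ha2, ← hrσ, ← hτσ]; ring
  set q := √(n * He : ℝ) with hq
  have hq0 : 0 ≤ q := Real.sqrt_nonneg _
  have hq2 : q ^ 2 = n * He := Real.sq_sqrt (by positivity)
  set ρ := √(20 * n * He / σ) * ε with hρ
  have hρ0 : 0 ≤ ρ := by positivity
  have hρ2 : ρ ^ 2 * σ = 20 * n * He * ε ^ 2 := by
    rw [hρ, mul_pow, Real.sq_sqrt (by positivity)]; field_simp
  have hsτ : ∀ (U : Matrix (Fin d₁ × Fin m) (Fin n) ℝ) (s : Fin n → ℝ)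
      (V : Matrix (Cols d₂ m p) (Fin n) ℝ), IsSVD (X * Y) U s V → ∀ i, τ ≤ s i := by
    intro U s V hs i
    have h1 := hsv U s V hs i
    rw [← hk2, ← mul_pow] at h1
    rw [hτ, div_le_iff₀' hk0]
    exact le_of_sq_le_sq h1 (mul_nonneg hk0.le (hs.nonneg i))
  -- `e² ≤ β σ² / 8 = β (1 + η) τ² / 8 ≤ 9 τ² / 64`.
  have heτ : e ≤ 3 / 8 * τ := by
    refine le_of_sq_le_sq ?_ (by positivity)
    have h1 : β * (8 * He * ε ^ 2) ≤ β * σ ^ 2 := by gcongr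
    have h2 : β * σ ^ 2 = β * (1 + η) * τ ^ 2 := by rw [← hk2, ← hτσ]; ring
    have h3 : β * (1 + η) * τ ^ 2 ≤ 9 / 8 * τ ^ 2 := by gcongr
    linarith
  -- The slack between 15 and 20 absorbs the factor `9 / 8`.
  have heρ : 15 * n * e ^ 2 ≤ τ * ρ ^ 2 := by
    have hβk : β * k ≤ 9 / 8 := by
      refine le_trans ?_ hβη
      rw [← hk2]
      have : k ≤ k ^ 2 := by nlinarith
      gcongr
    refine le_of_mul_le_mul_right ?_ hk0
    calc 15 * n * e ^ 2 * k ≤ 15 * n * (β * He * ε ^ 2) * k := by gcongr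
      _ = 15 * n * He * ε ^ 2 * (β * k) := by ring
      _ ≤ 15 * n * He * ε ^ 2 * (9 / 8) := by gcongr
      _ ≤ 20 * n * He * ε ^ 2 := by
          have : 0 ≤ n * He * ε ^ 2 := by positivity
          linarith
      _ = τ * ρ ^ 2 * k := by rw [← hρ2, ← hτσ]; ring
  have hHm := (norm_hankelMinus_le (hankel h G)).trans hHL
  obtain ⟨Q, hQ, hA, hrest⟩ := hout.exists_orthogonal h hd₁ hd₂ hout' hXY hτ0 hsτ le_rfl heτ hρ0 heρ ha0 haτ hL.le hHm
  refine ⟨Q, hQ, hA.trans ?_, hrest⟩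
  have hx := norm_hankelPlus_le (hankel h G)
  have hyσ : y ≤ σ := by
    refine le_of_sq_le_sq ?_ hσ.le
    have : 0 ≤ He * ε ^ 2 := by positivity
    linarith
  refine state_bound_le hk1 (by rw [hk2]; linarith) hL hr0 hrσ hσ hσH hHL hε0 hq0 ha0 ha2 hρ0
    ?_ ?_ hx ?_ ?_
  · refine le_of_sq_le_sq ?_ (by positivity)
    refine le_of_mul_le_mul_right ?_ hσ
    calc ρ ^ 2 * σ = 20 * (n * He * ε ^ 2) := by rw [hρ2]; ring
      _ ≤ 25 * (n * He * ε ^ 2) := by gcongr; norm_num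
      _ = 25 * q ^ 2 * ε ^ 2 * (r ^ 2 * σ) := by rw [hq2, hrσ]; ring
      _ = (5 * q * r * ε) ^ 2 * σ := by ring
  -- `ρ ≤ 1` is what the bound `hB` amounts to.
  · refine le_of_sq_le_sq ?_ zero_le_one
    refine le_of_mul_le_mul_right ?_ hσ
    rw [hρ2]; linarith
  · refine le_of_sq_le_sq (hyΔ.trans ?_) (by positivity)
    rw [mul_pow, hq2]
    have : (1 : ℝ) ≤ n := by exact_mod_cast hn
    have : (He : ℝ) ≤ n * He := le_mul_of_one_le_left hHe0.le this
    gcongr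
  · have h1 : hankelPlus (hankel h G') = hankelPlus (hankel h G)
        + (hankelPlus (hankel h G') - hankelPlus (hankel h G)) := by
      abel
    rw [h1]
    exact (norm_add_le _ _).trans (add_le_add hx hyσ)

end Main

end SysId

end

theorem mainTheorem7 {n m p : ℕ} (hn : 0 < n)
    (A : Matrix (Fin n) (Fin n) ℝ) (B : Matrix (Fin n) (Fin p) ℝ) (C : Matrix (Fin m) (Fin n) ℝ)
    (σw σz : ℝ) (S : Matrix (Fin n) (Fin n) ℝ) (hΘ : SysId.IsAdmissible A B C σw σz S) :
    ∃ c₁ : ℝ, 0 < c₁ ∧ ∀ lam υ : ℝ, 0 < lam → 0 < υ → υ < 1 →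
    ∃ cH : ℝ, 0 < cH ∧ ∀ T : ℕ, 1 ≤ T →
    ∀ (He d₁ d₂ : ℕ) (h : d₁ + d₂ + 1 = He) (hd₁ : n ≤ d₁) (hd₂ : n ≤ d₂),
    max (2 * (n : ℝ) + 1)
      (Real.log (cH * (T : ℝ) ^ 2 * √(m : ℝ) / √lam) / Real.log (1 / υ)) ≤ He →
    ∀ (G : Matrix (Fin m) (SysId.Cols He m p) ℝ)
      (H : Matrix (Fin d₁ × Fin m) (SysId.Cols (d₂ + 1) m p) ℝ),
    G = SysId.arxMatrix A B C (SysId.kalmanGain A C S σz) He →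
    H = SysId.hankel h G →
    H.rank = n ∧
    ∀ (A₀ : Matrix (Fin n) (Fin n) ℝ) (B₀ : Matrix (Fin n) (Fin p) ℝ)
      (C₀ : Matrix (Fin m) (Fin n) ℝ) (F₀ : Matrix (Fin n) (Fin m) ℝ),
    SysId.IsOutput h (hn.trans_le hd₁) (hn.trans_le hd₂) G A₀ B₀ C₀ F₀ →
    ∀ (Ghat : ℕ → Matrix (Fin m) (SysId.Cols He m p) ℝ) (TG : ℝ), 0 ≤ TG →
    (∀ s : ℕ, TG ≤ s → ‖Ghat s - G‖ ≤ √(TG / s)) →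
    ∀ t : ℕ,
    max TG (max (TG * (8 * He / SysId.sigma n H ^ 2)) (TG * (20 * n * He / SysId.sigma n H))) ≤ t →
    ∀ (Ahat : Matrix (Fin n) (Fin n) ℝ) (Bhat : Matrix (Fin n) (Fin p) ℝ)
      (Chat : Matrix (Fin m) (Fin n) ℝ) (Fhat : Matrix (Fin n) (Fin m) ℝ),
    SysId.IsOutput h (hn.trans_le hd₁) (hn.trans_le hd₂) (Ghat t) Ahat Bhat Chat Fhat →
    ∃ Q ∈ Matrix.orthogonalGroup (Fin n) ℝ,
      ‖Ahat - Qᵀ * A₀ * Q‖ ≤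
        c₁ * (√(n * He : ℝ) * (‖H‖ + SysId.sigma n H) / SysId.sigma n H ^ 2) * ‖Ghat t - G‖ ∧
      ‖Bhat - Qᵀ * B₀‖ ≤ √(20 * n * He / SysId.sigma n H) * ‖Ghat t - G‖ ∧
      ‖Chat - C₀ * Q‖ ≤ √(20 * n * He / SysId.sigma n H) * ‖Ghat t - G‖ ∧
      ‖Fhat - Qᵀ * F₀‖ ≤ √(20 * n * He / SysId.sigma n H) * ‖Ghat t - G‖ := by
  have hm := hΘ.pos_of_pos hn
  obtain ⟨L, b, η, hL, hb, hη, hηt, hsys⟩ := hΘ.exists_bounds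
  -- From `D` on, `1 + η d ≤ 9 / 8`, the loss that the constants tolerate.
  obtain ⟨D, hD⟩ := Filter.eventually_atTop.1
    (hηt.eventually (ge_mem_nhds (show (0 : ℝ) < 1 / 8 by norm_num)))
  refine ⟨92 * (1 + b) + 5 * (2 * L + 1) * L, by positivity, fun lam υ hlam hυ hυ1 => ?_⟩
  -- This size of `He` settles the case `d₂ < D`, where `1 + η d₂` is only known to be at most `1 +
  -- b`.
  obtain ⟨cH, hcH, hlog⟩ := SysId.exists_const_le_log_div hm hlam hυ hυ1 (m * D * (1 + b))
  refine ⟨cH, hcH, fun T hT He d₁ d₂ h hd₁ hd₂ hHe G H hG hH => ?_⟩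
  have hHeN : m * D * (1 + b) ≤ (He : ℝ) := (hlog T hT).trans ((le_max_right _ _).trans hHe)
  clear hHe hlog
  rw [hG] at hH
  obtain ⟨hrank, hHL, X, Y, hXY, hsv⟩ := hsys He d₁ d₂ h hd₁ hd₂ H hH
  rw [← hG] at hH
  refine ⟨hrank, fun A₀ B₀ C₀ F₀ hout Ghat TG hTG hrate t ht Ahat Bhat Chat Fhat hout' => ?_⟩
  have hσ := SysId.sigma_pos hn hrank
  have hσH := SysId.sigma_le_norm hn hrank
  set σ := SysId.sigma n H
  have hε0 := norm_nonneg (Ghat t - G)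
  have hε := hrate t ((le_max_left _ _).trans ht)
  set ε := ‖Ghat t - G‖ with hεdef
  have hHe0 : (0 : ℝ) < He := by exact_mod_cast (show 0 < He by omega)
  have hn0 : (0 : ℝ) < n := by exact_mod_cast hn
  have hN : 8 * He * ε ^ 2 ≤ σ ^ 2 :=
    SysId.sq_le_of_le_sqrt_div t.cast_nonneg hTG hε0 hε (by positivity) (by positivity)
      (((le_max_left _ _).trans (le_max_right _ _)).trans ht)
  have hB : 20 * n * He * ε ^ 2 ≤ σ :=
    SysId.sq_le_of_le_sqrt_div t.cast_nonneg hTG hε0 hε (by positivity) hσ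
      (((le_max_right _ _).trans (le_max_right _ _)).trans ht)
  have hd1He : (d₁ : ℝ) ≤ He := by exact_mod_cast (show d₁ ≤ He by omega)
  have hΔ : ‖SysId.hankel h (Ghat t) - SysId.hankel h G‖ ^ 2 ≤ He * ε ^ 2 := by
    rw [SysId.hankel_sub]
    exact (SysId.norm_hankel_sq_le h _).trans (by gcongr)
  set e := ‖SysId.hankelMinus (SysId.hankel h (Ghat t)) - SysId.hankelMinus (SysId.hankel h G)‖
    with he
  set y := ‖SysId.hankelPlus (SysId.hankel h (Ghat t)) - SysId.hankelPlus (SysId.hankel h G)‖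
    with hy
  have hyΔ : y ^ 2 ≤ He * ε ^ 2 := by
    refine le_trans ?_ hΔ
    rw [hy, SysId.hankelPlus_sub]
    exact pow_le_pow_left₀ (norm_nonneg _) (SysId.norm_hankelPlus_le _) 2
  obtain ⟨hη0, hηb⟩ := hη d₂
  -- `β` measures the perturbation of `H⁻` relative to `He ε²`. For `d₂ ≥ D` the block row bound
  -- gives `β = 1`; for `d₂ < D` the block column bound gives `β = m D / He`, small enough to
  -- compensate `1 + b`.
  obtain ⟨β, hβ0, heβ, hβη⟩ : ∃ β : ℝ, 0 ≤ β ∧ e ^ 2 ≤ β * He * ε ^ 2 ∧ β * (1 + η d₂) ≤ 9 / 8 := by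
    rcases le_or_gt D d₂ with hDd | hDd
    · refine ⟨1, zero_le_one, ?_, by linarith [hD d₂ hDd]⟩
      rw [one_mul]
      refine le_trans ?_ hΔ
      rw [he, SysId.hankelMinus_sub]
      exact pow_le_pow_left₀ (norm_nonneg _) (SysId.norm_hankelMinus_le _) 2
    · refine ⟨m * D / He, by positivity, ?_, ?_⟩
      · rw [div_mul_cancel₀ _ hHe0.ne', he, SysId.hankelMinus_sub, SysId.hankel_sub]
        refine (SysId.norm_hankelMinus_hankel_sq_le h _).trans ?_
        have : (d₂ : ℝ) ≤ D := by exact_mod_cast hDd.le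
        gcongr
      · have h1 : m * D / He * (1 + η d₂) ≤ 1 := by
          rw [div_mul_eq_mul_div, div_le_one hHe0]
          refine le_trans ?_ hHeN
          gcongr
        linarith
  subst hH
  exact hout.error_bounds hn h (hn.trans_le hd₁) (hn.trans_le hd₂) hout' hXY hL hη0 hηb hβ0 hβη hσ
    hσH hHL hsv hε0 hN hB heβ hyΔ
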